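/- Let $S$ be any ring, write $\otimes=\otimes_S$, let $V$ be an $S,S$-bimodule and let $T_S(V)=\bigoplus_{n\ge 1}V^{n}$, $V^n=V^{\otimes n}$, be its non-unital tensor algebra. Let $I=\bigoplus_{n\ge 2}R_n$, $R_n\subseteq V^n$, be a homogeneous two-sided ideal (and sub-bimodule) of $T_S(V)$ contained in $V^{(2)}=\bigoplus_{n\ge2}V^n$, and let $A=T_S(V)/I$. A closed non-degenerate bracketing is either a single input $\bullet$ or $\beta=[\beta_1\cdots\beta_k]$ with $k\ge 2$ and all $\beta_i$ closed non-degenerate bracketings. Define bimodules $(V,I)^\beta$ by $(V,I)^\bullet=V$; $(V,I)^{[\bullet\cdots\bullet]}=R_n$ for a bracket around $n$ inputs only; and $(V,I)^{[\beta_1\cdots\beta_k]}=(V,I)^{\beta_1}\otimes\cdots\otimes(V,I)^{\beta_k}$ if some $\beta_i\neq\bullet$. Put $(V,I)^\beta$ in homological degree $d$ if $\beta$ has $d-1$ pairs of brackets, and let $$B^\infty_\bullet(V,I)=\bigoplus_{\beta}(V,I)^\beta ,$$ the sum over all closed non-degenerate bracketings. Define coproducts $\Delta_k: B^\infty_\bullet(V,I)\to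 B^\infty_\bullet(V,I)^{\otimes k}$, $k\ge1$, as follows. * On $(V,I)^\bullet=V$ all $\Delta_k$ vanish. * The components of $\Delta_1$ on $(V,I)^\beta$ are, for each internal (i.e. not the outer) left bracket of $\beta$, say the $m$-th one from the left, $(-1)^{m-1}$ times the canonical map $(V,I)^\beta\to(V,I)^{\beta(\widehat m)}$, where $\beta(\widehat m)$ is $\beta$ with that bracket and its matching right bracket removed. This map is the tautological one if the removed bracket contains further brackets; if it encloses only $n$ inputs, it is induced by the multiplication $V^a\otimes R_n\otimes V^b\to R_{a+n+b}$ if its removal leaves an innermost bracket around $a+n+b$ inputs, and by the inclusion $R_n\subseteq V^n$ otherwise. * For $\beta=[\beta_1\cdots\beta_k]$ with $k\ge2$, the only other coproduct on $(V,I)^\beta$ is $\Delta_k:(V,I)^\beta\to(V,I)^{\beta_1}\otimes\cdots\otimes(V,I)^{\beta_k}$, equal to $-(-1)^{\sum_{i=1}^k(k-i)d_i}$ times the tautological map (the inclusion $R_k\subseteq V^k$ if all $\beta_i=\bullet$), where $d_i$ is the homological degree of $(V,I)^{\beta_i}$. Then: 1. $K_\bullet=B^\infty_\bullet(V,I)$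 with these coproducts is an $A_\infty$-coalgebra: $\Delta_k$ maps $K_n$ to the part of degree $n-2+k$ of $K_\bullet^{\otimes k}$, and $\sum_{r+s+t=n}(-1)^{r+st}(1^{\otimes r}\otimes\Delta_s\otimes1^{\otimes t})\circ\Delta_{r+1+t}=0$ for all $n\ge1$ (sum over $r,t\ge 0$, $s\ge 1$, with the Koszul sign rule). 2. Its cobar construction $\operatorname{Cobar}K_\bullet=(T_S(K_\bullet[1]),d)$, where $K[1]_n=K_{n+1}$ and $d$ is the extension by the graded Leibniz rule $d(xy)=(dx)y+(-1)^{\deg x}x(dy)$ of $-\sum_k[1]^{\otimes k}\circ\Delta_k\circ[-1]$ (Koszul sign rule for $[1]^{\otimes k}$, so that $[1]^{\otimes k}$ has sign $(-1)^{\sum_i(k-i)m_i}$ on $K_{m_1}\otimes\cdots\otimes K_{m_k}$), is a non-unital differential graded $S$-algebra, graded in non-negative degrees with $d$ of degree $-1$ and $d^2=0$. 3. The quotient map $V\to A$ on $K_1=V$ extends to a morphism of differential graded $S$-algebras $\rho:\operatorname{Cobar}B^\infty_\bullet(V,I)\to A$, where $A$ is concentrated in degree $0$ with zero differential, and $\rho$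 is a quasi-isomorphism, i.e. it induces isomorphisms on homology in all degrees. -/

import Mathlib

universe u v

open scoped TensorProduct DirectSum
open MulOpposite (op)

noncomputable section

namespace BracketCobar

/-! ## Bimodules over an arbitrary (not necessarily commutative) ring -/

/-- An `S,S`-bimodule: the right action is an action of the opposite ring `Sᵐᵒᵖ` commuting with the
left action. -/
structure Bimodule (S : Type u) [Ring S] where
  carrier : Type v
  [addCommGroup : AddCommGroup carrier]
  [left : Module S carrier]
  [right : Module Sᵐᵒᵖ carrier]
  [comm : SMulCommClass S Sᵐᵒᵖ carrier]

attribute [instance] Bimodule.addCommGroup Bimodule.left Bimodule.right Bimodule.comm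

instance {S : Type u} [Ring S] : CoeSort (Bimodule.{u, v} S) (Type v) := ⟨Bimodule.carrier⟩

variable {S : Type u} [Ring S]

/-- The additive group of homomorphisms of bimodules. -/
def homSubgroup (M N : Bimodule.{u, v} S) : AddSubgroup (M →+ N) where
  carrier := {f | ∀ (s : S) (m : M), f (s • m) = s • f m ∧ f (op s • m) = op s • f m}
  zero_mem' := by intro s m; simp
  add_mem' := by
    intro f g hf hg s m
    simp [(hf s m).1, (hf s m).2, (hg s m).1, (hg s m).2]
  neg_mem' := by
    intro f hf s m
    simp [(hf s m).1, (hf s m).2]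

/-- Homomorphisms of bimodules `M → N`. -/
abbrev Hom (M N : Bimodule.{u, v} S) : Type v := ↥(homSubgroup M N)

instance (M N : Bimodule.{u, v} S) : CoeFun (Hom M N) (fun _ => M → N) := ⟨fun f => f.1⟩

/-- The identity homomorphism. -/
def Hom.id (M : Bimodule.{u, v} S) : Hom M M :=
  ⟨AddMonoidHom.id M, fun _ _ => ⟨rfl, rfl⟩⟩

/-- Composition `g ∘ f`. -/
def Hom.comp {M N P : Bimodule.{u, v} S} (g : Hom N P) (f : Hom M N) : Hom M P :=
  ⟨g.1.comp f.1, fun s m => by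
    simp [(f.2 s m).1, (f.2 s m).2, (g.2 s (f.1 m)).1, (g.2 s (f.1 m)).2]⟩

/-! ### Tensor products over `S` -/

/-- The additive subgroup of `M ⊗_ℤ N` generated by the elements `m s ⊗ n - m ⊗ s n`. -/
def balancing (M N : Bimodule.{u, v} S) : AddSubgroup (M ⊗[ℤ] N) :=
  AddSubgroup.closure {z | ∃ (m : M) (s : S) (n : N), z = (op s • m) ⊗ₜ[ℤ] n - m ⊗ₜ[ℤ] (s • n)}

/-- The underlying additive group of `M ⊗_S N`, the quotient of `M ⊗_ℤ N` by the relations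
`m s ⊗ n = m ⊗ s n`. -/
abbrev TensorCarrier (M N : Bimodule.{u, v} S) : Type v := (M ⊗[ℤ] N) ⧸ balancing M N

/-- The pure tensor `m ⊗ n` in `M ⊗_S N`, as a biadditive map. -/
def tmul (M N : Bimodule.{u, v} S) : M →+ N →+ TensorCarrier M N :=
  AddMonoidHom.mk' (fun m => AddMonoidHom.mk' (fun n => QuotientAddGroup.mk (m ⊗ₜ[ℤ] n))
    (fun a b => by rw [TensorProduct.tmul_add]; rfl))
    (fun a b => by ext n; simp [TensorProduct.add_tmul])

theorem tmul_balanced {M N : Bimodule.{u, v} S} (m : M) (s : S) (n : N) :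
    tmul M N (op s • m) n = tmul M N m (s • n) := by
  refine (QuotientAddGroup.eq_iff_sub_mem).2 ?_
  exact AddSubgroup.subset_closure ⟨m, s, n, rfl⟩

/-- A balanced biadditive map induces an additive map on `M ⊗_S N`. -/
def liftAdd {M N : Bimodule.{u, v} S} {P : Type v} [AddCommGroup P] (f : M →+ N →+ P)
    (hf : ∀ (m : M) (s : S) (n : N), f (op s • m) n = f m (s • n)) : TensorCarrier M N →+ P :=
  QuotientAddGroup.lift (balancing M N)
    (TensorProduct.liftAddHom f (fun r m n => by simp))
    (by
      refine (AddSubgroup.closure_le _).2 ?_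
      rintro z ⟨m, s, n, rfl⟩
      simp [hf])

theorem liftAdd_tmul {M N : Bimodule.{u, v} S} {P : Type v} [AddCommGroup P] (f : M →+ N →+ P)
    (hf : ∀ (m : M) (s : S) (n : N), f (op s • m) n = f m (s • n)) (m : M) (n : N) :
    liftAdd f hf (tmul M N m n) = f m n := rfl

theorem tensor_hom_ext {M N : Bimodule.{u, v} S} {P : Type*} [AddCommGroup P]
    {f g : TensorCarrier M N →+ P} (h : ∀ m n, f (tmul M N m n) = g (tmul M N m n)) : f = g := by
  refine DFunLike.ext _ _ fun z => ?_
  obtain ⟨z, rfl⟩ := QuotientAddGroup.mk_surjective z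
  induction z with
  | zero => simp
  | tmul m n => exact h m n
  | add x y hx hy => simp_all

/-- The left action of `S` on `M ⊗_S N`: `s (m ⊗ n) = (s m) ⊗ n`. -/
def leftAct (M N : Bimodule.{u, v} S) (s : S) : TensorCarrier M N →+ TensorCarrier M N :=
  liftAdd ((tmul M N).comp (DistribSMul.toAddMonoidHom M s)) (fun m t n => by
    simp [smul_comm s (op t) m, tmul_balanced])

/-- The right action of `S` on `M ⊗_S N`: `(m ⊗ n) s = m ⊗ (n s)`. -/
def rightAct (M N : Bimodule.{u, v} S) (s : Sᵐᵒᵖ) : TensorCarrier M N →+ TensorCarrier M N :=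
  liftAdd ((AddMonoidHom.compHom.flip (DistribSMul.toAddMonoidHom N s)).comp (tmul M N))
    (fun m t n => by simp [tmul_balanced, smul_comm t s n])

theorem leftAct_tmul {M N : Bimodule.{u, v} S} (s : S) (m : M) (n : N) :
    leftAct M N s (tmul M N m n) = tmul M N (s • m) n := rfl

theorem rightAct_tmul {M N : Bimodule.{u, v} S} (s : Sᵐᵒᵖ) (m : M) (n : N) :
    rightAct M N s (tmul M N m n) = tmul M N m (s • n) := rfl

instance (M N : Bimodule.{u, v} S) : Module S (TensorCarrier M N) where
  smul := fun s => leftAct M N s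
  one_smul := DFunLike.congr_fun (f := leftAct M N 1) (g := AddMonoidHom.id _)
    (tensor_hom_ext fun m n => by simp [leftAct_tmul])
  mul_smul := fun s t => DFunLike.congr_fun (f := leftAct M N (s * t))
    (g := (leftAct M N s).comp (leftAct M N t))
    (tensor_hom_ext fun m n => by simp [leftAct_tmul, mul_smul])
  smul_zero := fun s => map_zero (leftAct M N s)
  smul_add := fun s => map_add (leftAct M N s)
  add_smul := fun s t => DFunLike.congr_fun (f := leftAct M N (s + t))
    (g := leftAct M N s + leftAct M N t)
    (tensor_hom_ext fun m n => by simp [leftAct_tmul, add_smul])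
  zero_smul := DFunLike.congr_fun (f := leftAct M N 0) (g := 0)
    (tensor_hom_ext fun m n => by simp [leftAct_tmul])

instance (M N : Bimodule.{u, v} S) : Module Sᵐᵒᵖ (TensorCarrier M N) where
  smul := fun s => rightAct M N s
  one_smul := DFunLike.congr_fun (f := rightAct M N 1) (g := AddMonoidHom.id _)
    (tensor_hom_ext fun m n => by simp [rightAct_tmul])
  mul_smul := fun s t => DFunLike.congr_fun (f := rightAct M N (s * t))
    (g := (rightAct M N s).comp (rightAct M N t))
    (tensor_hom_ext fun m n => by simp [rightAct_tmul, mul_smul])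
  smul_zero := fun s => map_zero (rightAct M N s)
  smul_add := fun s => map_add (rightAct M N s)
  add_smul := fun s t => DFunLike.congr_fun (f := rightAct M N (s + t))
    (g := rightAct M N s + rightAct M N t)
    (tensor_hom_ext fun m n => by simp [rightAct_tmul, add_smul])
  zero_smul := DFunLike.congr_fun (f := rightAct M N 0) (g := 0)
    (tensor_hom_ext fun m n => by simp [rightAct_tmul])

instance (M N : Bimodule.{u, v} S) : SMulCommClass S Sᵐᵒᵖ (TensorCarrier M N) where
  smul_comm := fun s t => DFunLike.congr_fun (f := (leftAct M N s).comp (rightAct M N t))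
    (g := (rightAct M N t).comp (leftAct M N s))
    (tensor_hom_ext fun m n => by simp [leftAct_tmul, rightAct_tmul])

/-- The tensor product `M ⊗_S N` of bimodules. -/
def tensor (M N : Bimodule.{u, v} S) : Bimodule.{u, v} S where
  carrier := TensorCarrier M N

/-- The pure tensor `m ⊗ n` as an element of the bimodule `M ⊗_S N`. -/
def tm {M N : Bimodule.{u, v} S} (m : M) (n : N) : tensor M N := tmul M N m n

/-- A balanced biadditive map which is linear on the left in the first and on the right in the
second variable induces a homomorphism of bimodules on `M ⊗_S N`. -/
def lift {M N P : Bimodule.{u, v} S} (f : M →+ N →+ P)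
    (hf : ∀ (m : M) (s : S) (n : N), f (op s • m) n = f m (s • n))
    (hl : ∀ (s : S) (m : M) (n : N), f (s • m) n = s • f m n)
    (hr : ∀ (s : S) (m : M) (n : N), f m (op s • n) = op s • f m n) : Hom (tensor M N) P :=
  ⟨liftAdd f hf, fun s z => ⟨
    DFunLike.congr_fun (f := (liftAdd f hf).comp (leftAct M N s))
      (g := (DistribSMul.toAddMonoidHom P s).comp (liftAdd f hf))
      (tensor_hom_ext fun m n => hl s m n) z,
    DFunLike.congr_fun (f := (liftAdd f hf).comp (rightAct M N (op s)))
      (g := (DistribSMul.toAddMonoidHom P (op s)).comp (liftAdd f hf))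
      (tensor_hom_ext fun m n => hr s m n) z⟩⟩

/-- The biadditive map `(m, n) ↦ F (m ⊗ n)`. -/
def curry {M N P : Bimodule.{u, v} S} (F : Hom (tensor M N) P) : M →+ N →+ P :=
  (AddMonoidHom.compHom (F.1 : TensorCarrier M N →+ P)).comp (tmul M N)

theorem curry_bal {M N P : Bimodule.{u, v} S} (F : Hom (tensor M N) P) (m : M) (s : S) (n : N) :
    curry F (op s • m) n = curry F m (s • n) :=
  congrArg F.1 (tmul_balanced m s n)

theorem curry_left {M N P : Bimodule.{u, v} S} (F : Hom (tensor M N) P) (s : S) (m : M) (n : N) :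
    curry F (s • m) n = s • curry F m n := (F.2 s (tm m n)).1

theorem curry_right {M N P : Bimodule.{u, v} S} (F : Hom (tensor M N) P) (s : S) (m : M) (n : N) :
    curry F m (op s • n) = op s • curry F m n := (F.2 s (tm m n)).2

/-- The tensor product `f ⊗ g` of homomorphisms. -/
def map {M M' N N' : Bimodule.{u, v} S} (f : Hom M M') (g : Hom N N') :
    Hom (tensor M N) (tensor M' N') :=
  lift ((AddMonoidHom.compHom.flip g.1).comp ((tmul M' N').comp f.1))
    (fun m s n => by
      have h := tmul_balanced (f.1 m) s (g.1 n)
      rw [← (f.2 s m).2, ← (g.2 s n).1] at h; exact h)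
    (fun s m n => by
      have h := (leftAct_tmul s (f.1 m) (g.1 n)).symm
      rw [← (f.2 s m).1] at h; exact h)
    (fun s m n => by
      have h := (rightAct_tmul (op s) (f.1 m) (g.1 n)).symm
      rw [← (g.2 s n).2] at h; exact h)

/-- The biadditive map `(m ⊗ n, p) ↦ m ⊗ (n ⊗ p)`. -/
def assocAdd (M N P : Bimodule.{u, v} S) :
    TensorCarrier M N →+ P →+ TensorCarrier M (tensor N P) :=
  liftAdd (M := M) (N := N) (P := P →+ TensorCarrier M (tensor N P))
    (AddMonoidHom.mk' (fun m => AddMonoidHom.mk' (fun n =>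
        (tmul M (tensor N P) m).comp (tmul N P n))
        (fun a b => by
          ext p; exact (congrArg (tmul M (tensor N P) m)
            (DFunLike.congr_fun (map_add (tmul N P) a b) p)).trans (map_add _ _ _)))
      (fun a b => by
        ext n p; exact DFunLike.congr_fun (map_add (tmul M (tensor N P)) a b) _))
    (fun m s n => by ext p; exact tmul_balanced (N := tensor N P) m s (tm n p))

/-- The associativity map `(M ⊗ N) ⊗ P → M ⊗ (N ⊗ P)`. -/
def assoc (M N P : Bimodule.{u, v} S) :
    Hom (tensor (tensor M N) P) (tensor M (tensor N P)) :=
  lift (M := tensor M N) (N := P) (P := tensor M (tensor N P)) (assocAdd M N P)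
    (fun z s p => DFunLike.congr_fun
      (f := ((AddMonoidHom.eval p).comp (assocAdd M N P)).comp (rightAct M N (op s)))
      (g := (AddMonoidHom.eval (s • p)).comp (assocAdd M N P))
      (tensor_hom_ext fun m n => congrArg (tmul M (tensor N P) m) (tmul_balanced n s p)) z)
    (fun s z p => DFunLike.congr_fun
      (f := ((AddMonoidHom.eval p).comp (assocAdd M N P)).comp (leftAct M N s))
      (g := (leftAct M (tensor N P) s).comp ((AddMonoidHom.eval p).comp (assocAdd M N P)))
      (tensor_hom_ext fun _ _ => rfl) z)
    (fun s z p => DFunLike.congr_fun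
      (f := (AddMonoidHom.eval (op s • p)).comp (assocAdd M N P))
      (g := (rightAct M (tensor N P) (op s)).comp
        ((AddMonoidHom.eval p).comp (assocAdd M N P)))
      (tensor_hom_ext fun _ _ => rfl) z)

theorem assoc_tm {M N P : Bimodule.{u, v} S} (m : M) (n : N) (p : P) :
    assoc M N P (tm (tm m n) p) = tm m (tm n p) := rfl

/-! ### Direct sums -/

/-- The direct sum of a family of bimodules. -/
def sum {ι : Type} (M : ι → Bimodule.{u, v} S) : Bimodule.{u, v} S where
  carrier := ⨁ i, M i

open scoped Classical in
/-- The inclusion of a summand. -/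
def incl {ι : Type} (M : ι → Bimodule.{u, v} S) (i : ι) : Hom (M i) (sum M) :=
  ⟨DirectSum.of (fun i => (M i : Type v)) i, fun s m =>
    ⟨DirectSum.of_smul (M := fun i => (M i : Type v)) S i s m,
      DirectSum.of_smul (M := fun i => (M i : Type v)) Sᵐᵒᵖ i (op s) m⟩⟩

/-- The projection to a summand. -/
def proj {ι : Type} (M : ι → Bimodule.{u, v} S) (i : ι) : Hom (sum M) (M i) :=
  ⟨DFinsupp.evalAddMonoidHom i, fun _ _ => ⟨rfl, rfl⟩⟩

open scoped Classical in
/-- The homomorphism out of a direct sum with given restrictions to the summands. -/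
def sumLift {ι : Type} {M : ι → Bimodule.{u, v} S} {P : Bimodule.{u, v} S}
    (F : ∀ i, Hom (M i) P) : Hom (sum M) P :=
  ⟨DirectSum.toAddMonoid (fun i => (F i).1), fun s z => by
    constructor
    · refine DFunLike.congr_fun (f := (DirectSum.toAddMonoid (fun i => (F i).1)).comp
        (DistribSMul.toAddMonoidHom (⨁ i, (M i : Type v)) s))
        (g := (DistribSMul.toAddMonoidHom P s).comp (DirectSum.toAddMonoid (fun i => (F i).1)))
        (DirectSum.addHom_ext fun i m => ?_) z
      simp [← DirectSum.of_smul, ((F i).2 s m).1]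
    · refine DFunLike.congr_fun (f := (DirectSum.toAddMonoid (fun i => (F i).1)).comp
        (DistribSMul.toAddMonoidHom (⨁ i, (M i : Type v)) (op s)))
        (g := (DistribSMul.toAddMonoidHom P (op s)).comp
          (DirectSum.toAddMonoid (fun i => (F i).1)))
        (DirectSum.addHom_ext fun i m => ?_) z
      simp [← DirectSum.of_smul, ((F i).2 s m).2]⟩

open scoped Classical in
/-- A family of homomorphisms `M i ⊗ N → P` induces `(⨁ M i) ⊗ N → P`. -/
def sumTensorLift {ι : Type} {M : ι → Bimodule.{u, v} S} {N P : Bimodule.{u, v} S}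
    (F : ∀ i, Hom (tensor (M i) N) P) : Hom (tensor (sum M) N) P :=
  lift (M := sum M) (DirectSum.toAddMonoid (fun i => curry (F i)))
    (fun z s n => DFunLike.congr_fun
      (f := ((AddMonoidHom.eval n).comp (DirectSum.toAddMonoid (fun i => curry (F i)))).comp
        (DistribSMul.toAddMonoidHom (⨁ i, (M i : Type v)) (op s)))
      (g := (AddMonoidHom.eval (s • n)).comp (DirectSum.toAddMonoid (fun i => curry (F i))))
      (DirectSum.addHom_ext fun i m => by
        simp [← DirectSum.of_smul, curry_bal]) z)
    (fun s z n => DFunLike.congr_fun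
      (f := ((AddMonoidHom.eval n).comp (DirectSum.toAddMonoid (fun i => curry (F i)))).comp
        (DistribSMul.toAddMonoidHom (⨁ i, (M i : Type v)) s))
      (g := (DistribSMul.toAddMonoidHom P s).comp
        ((AddMonoidHom.eval n).comp (DirectSum.toAddMonoid (fun i => curry (F i)))))
      (DirectSum.addHom_ext fun i m => by
        simp [← DirectSum.of_smul, curry_left]) z)
    (fun s z n => DFunLike.congr_fun
      (f := (AddMonoidHom.eval (op s • n)).comp (DirectSum.toAddMonoid (fun i => curry (F i))))
      (g := (DistribSMul.toAddMonoidHom P (op s)).comp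
        ((AddMonoidHom.eval n).comp (DirectSum.toAddMonoid (fun i => curry (F i)))))
      (DirectSum.addHom_ext fun i m => by
        simp [curry_right]) z)

open scoped Classical in
/-- A family of homomorphisms `N ⊗ M i → P` induces `N ⊗ (⨁ M i) → P`. -/
def tensorSumLift {ι : Type} {M : ι → Bimodule.{u, v} S} {N P : Bimodule.{u, v} S}
    (F : ∀ i, Hom (tensor N (M i)) P) : Hom (tensor N (sum M)) P :=
  lift (N := sum M) (AddMonoidHom.flip (DirectSum.toAddMonoid (fun i => (curry (F i)).flip)))
    (fun n s z => DFunLike.congr_fun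
      (f := (AddMonoidHom.eval (op s • n)).comp
        (DirectSum.toAddMonoid (fun i => (curry (F i)).flip)))
      (g := ((AddMonoidHom.eval n).comp
        (DirectSum.toAddMonoid (fun i => (curry (F i)).flip))).comp
        (DistribSMul.toAddMonoidHom (⨁ i, (M i : Type v)) s))
      (DirectSum.addHom_ext fun i m => by
        simp [← DirectSum.of_smul, curry_bal]) z)
    (fun s n z => DFunLike.congr_fun
      (f := (AddMonoidHom.eval (s • n)).comp
        (DirectSum.toAddMonoid (fun i => (curry (F i)).flip)))
      (g := (DistribSMul.toAddMonoidHom P s).comp ((AddMonoidHom.eval n).comp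
        (DirectSum.toAddMonoid (fun i => (curry (F i)).flip))))
      (DirectSum.addHom_ext fun i m => by
        simp [curry_left]) z)
    (fun s n z => DFunLike.congr_fun
      (f := ((AddMonoidHom.eval n).comp
        (DirectSum.toAddMonoid (fun i => (curry (F i)).flip))).comp
        (DistribSMul.toAddMonoidHom (⨁ i, (M i : Type v)) (op s)))
      (g := (DistribSMul.toAddMonoidHom P (op s)).comp ((AddMonoidHom.eval n).comp
        (DirectSum.toAddMonoid (fun i => (curry (F i)).flip))))
      (DirectSum.addHom_ext fun i m => by
        simp [← DirectSum.of_smul, curry_right]) z)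

/-! ### Sub-bimodules and quotients -/

/-- A sub-bimodule. -/
structure SubBimodule (M : Bimodule.{u, v} S) extends AddSubgroup M where
  left_mem : ∀ (s : S) {m : M}, m ∈ toAddSubgroup → s • m ∈ toAddSubgroup
  right_mem : ∀ (s : Sᵐᵒᵖ) {m : M}, m ∈ toAddSubgroup → s • m ∈ toAddSubgroup

instance {M : Bimodule.{u, v} S} (N : SubBimodule M) : Module S ↥N.toAddSubgroup where
  smul := fun s x => ⟨s • x.1, N.left_mem s x.2⟩
  one_smul := fun x => Subtype.ext (one_smul S x.1)
  mul_smul := fun s t x => Subtype.ext (mul_smul s t x.1)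
  smul_zero := fun s => Subtype.ext (smul_zero s)
  smul_add := fun s x y => Subtype.ext (smul_add s x.1 y.1)
  add_smul := fun s t x => Subtype.ext (add_smul s t x.1)
  zero_smul := fun x => Subtype.ext (zero_smul S x.1)

instance {M : Bimodule.{u, v} S} (N : SubBimodule M) : Module Sᵐᵒᵖ ↥N.toAddSubgroup where
  smul := fun s x => ⟨s • x.1, N.right_mem s x.2⟩
  one_smul := fun x => Subtype.ext (one_smul Sᵐᵒᵖ x.1)
  mul_smul := fun s t x => Subtype.ext (mul_smul s t x.1)
  smul_zero := fun s => Subtype.ext (smul_zero s)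
  smul_add := fun s x y => Subtype.ext (smul_add s x.1 y.1)
  add_smul := fun s t x => Subtype.ext (add_smul s t x.1)
  zero_smul := fun x => Subtype.ext (zero_smul Sᵐᵒᵖ x.1)

/-- A sub-bimodule, as a bimodule. -/
def SubBimodule.toBimodule {M : Bimodule.{u, v} S} (N : SubBimodule M) : Bimodule.{u, v} S where
  carrier := ↥N.toAddSubgroup
  comm := ⟨fun s t x => Subtype.ext (smul_comm s t x.1)⟩

/-- The inclusion of a sub-bimodule. -/
def SubBimodule.subtype {M : Bimodule.{u, v} S} (N : SubBimodule M) : Hom N.toBimodule M :=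
  ⟨N.toAddSubgroup.subtype, fun _ _ => ⟨rfl, rfl⟩⟩

/-- The preimage of a sub-bimodule. -/
def SubBimodule.comap {M P : Bimodule.{u, v} S} (f : Hom M P) (N : SubBimodule P) :
    SubBimodule M where
  toAddSubgroup := N.toAddSubgroup.comap f.1
  left_mem := by
    intro s m hm
    have h := N.left_mem s hm
    rwa [← (f.2 s m).1] at h
  right_mem := by
    intro s m hm
    have h := N.right_mem s hm
    have e := (f.2 s.unop m).2
    rw [MulOpposite.op_unop] at e
    rwa [← e] at h

/-- A homomorphism with values in a sub-bimodule. -/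
def SubBimodule.codRestrict {M P : Bimodule.{u, v} S} (N : SubBimodule P) (f : Hom M P)
    (h : ∀ x, f x ∈ N.toAddSubgroup) : Hom M N.toBimodule :=
  ⟨f.1.codRestrict N.toAddSubgroup h, fun s m =>
    ⟨Subtype.ext (f.2 s m).1, Subtype.ext (f.2 s m).2⟩⟩

/-- Scalar multiplication by `s` on the quotient by a sub-bimodule. -/
def SubBimodule.quotLeft {M : Bimodule.{u, v} S} (N : SubBimodule M) (s : S) :
    M ⧸ N.toAddSubgroup →+ M ⧸ N.toAddSubgroup :=
  QuotientAddGroup.map _ _ (DistribSMul.toAddMonoidHom M s) (fun _ h => N.left_mem s h)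

/-- Right scalar multiplication by `s` on the quotient by a sub-bimodule. -/
def SubBimodule.quotRight {M : Bimodule.{u, v} S} (N : SubBimodule M) (s : Sᵐᵒᵖ) :
    M ⧸ N.toAddSubgroup →+ M ⧸ N.toAddSubgroup :=
  QuotientAddGroup.map _ _ (DistribSMul.toAddMonoidHom M s) (fun _ h => N.right_mem s h)

instance {M : Bimodule.{u, v} S} (N : SubBimodule M) : Module S (M ⧸ N.toAddSubgroup) where
  smul := fun s => N.quotLeft s
  one_smul := by
    rintro ⟨x⟩; exact congrArg QuotientAddGroup.mk (one_smul S x)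
  mul_smul := by
    rintro s t ⟨x⟩; exact congrArg QuotientAddGroup.mk (mul_smul s t x)
  smul_zero := fun s => map_zero (N.quotLeft s)
  smul_add := fun s => map_add (N.quotLeft s)
  add_smul := by
    rintro s t ⟨x⟩; exact congrArg QuotientAddGroup.mk (add_smul s t x)
  zero_smul := by
    rintro ⟨x⟩; exact congrArg QuotientAddGroup.mk (zero_smul S x)

instance {M : Bimodule.{u, v} S} (N : SubBimodule M) : Module Sᵐᵒᵖ (M ⧸ N.toAddSubgroup) where
  smul := fun s => N.quotRight s
  one_smul := by
    rintro ⟨x⟩; exact congrArg QuotientAddGroup.mk (one_smul Sᵐᵒᵖ x)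
  mul_smul := by
    rintro s t ⟨x⟩; exact congrArg QuotientAddGroup.mk (mul_smul s t x)
  smul_zero := fun s => map_zero (N.quotRight s)
  smul_add := fun s => map_add (N.quotRight s)
  add_smul := by
    rintro s t ⟨x⟩; exact congrArg QuotientAddGroup.mk (add_smul s t x)
  zero_smul := by
    rintro ⟨x⟩; exact congrArg QuotientAddGroup.mk (zero_smul Sᵐᵒᵖ x)

/-- The quotient of a bimodule by a sub-bimodule. -/
def SubBimodule.quotient {M : Bimodule.{u, v} S} (N : SubBimodule M) : Bimodule.{u, v} S where
  carrier := M ⧸ N.toAddSubgroup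
  comm := ⟨by
    rintro s t ⟨x⟩; exact congrArg QuotientAddGroup.mk (smul_comm s t x)⟩

/-- The quotient homomorphism. -/
def SubBimodule.mkQ {M : Bimodule.{u, v} S} (N : SubBimodule M) : Hom M N.quotient :=
  ⟨QuotientAddGroup.mk' N.toAddSubgroup, fun _ _ => ⟨rfl, rfl⟩⟩

/-! ### The non-unital tensor algebra -/

/-- Tensor powers over `S`: `pow M n` is `M ⊗ (M ⊗ (⋯ ⊗ M))` with `n + 1` factors. -/
def pow (M : Bimodule.{u, v} S) : ℕ → Bimodule.{u, v} S
  | 0 => M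
  | n + 1 => tensor M (pow M n)

/-- The non-unital tensor algebra `⨁_{n ≥ 1} M^{⊗ n}`. -/
abbrev talg (M : Bimodule.{u, v} S) : Bimodule.{u, v} S := sum (pow M)

/-- The inclusion of the `(n+1)`-st tensor power into the tensor algebra. -/
abbrev tincl (M : Bimodule.{u, v} S) (n : ℕ) : Hom (pow M n) (talg M) := incl (pow M) n

/-- The projection of the tensor algebra to the `(n+1)`-st tensor power. -/
abbrev tproj (M : Bimodule.{u, v} S) (n : ℕ) : Hom (talg M) (pow M n) := proj (pow M) n

/-- Multiplication by one letter, `x ⊗ w ↦ x w`. -/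
def tcons (M : Bimodule.{u, v} S) : Hom (tensor M (talg M)) (talg M) :=
  tensorSumLift (fun n => tincl M (n + 1))

/-- Multiplication by a word with `n + 1` letters. -/
def tmulPow (M : Bimodule.{u, v} S) : (n : ℕ) → Hom (tensor (pow M n) (talg M)) (talg M)
  | 0 => tcons M
  | n + 1 => (tcons M).comp ((map (Hom.id M) (tmulPow M n)).comp (assoc M (pow M n) (talg M)))

/-- Multiplication in the tensor algebra, that is, concatenation of words. -/
def tmult (M : Bimodule.{u, v} S) : Hom (tensor (talg M) (talg M)) (talg M) :=
  sumTensorLift (tmulPow M)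

/-! ## Differential graded algebras and quasi-isomorphisms -/

/-- The data of a non-unital differential graded `S`-algebra: a bimodule `B`, an `S`-balanced
multiplication, homogeneous parts of degree `n ≥ 0`, and a differential. -/
structure DGData (S : Type u) [Ring S] where
  B : Bimodule.{u, v} S
  mult : Hom (tensor B B) B
  gr : ℕ → AddSubgroup B
  d : Hom B B

/-- The laws of a non-unital differential graded `S`-algebra with differential of degree `-1`. -/
structure DGData.IsDGAlgebra (C : DGData.{u, v} S) : Prop where
  mul_assoc : ∀ x y z : C.B, C.mult (tm (C.mult (tm x y)) z) = C.mult (tm x (C.mult (tm y z)))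
  left_gr : ∀ n (s : S), ∀ x ∈ C.gr n, s • x ∈ C.gr n
  right_gr : ∀ n (s : S), ∀ x ∈ C.gr n, op s • x ∈ C.gr n
  internal : DirectSum.IsInternal C.gr
  mul_gr : ∀ m n, ∀ x ∈ C.gr m, ∀ y ∈ C.gr n, C.mult (tm x y) ∈ C.gr (m + n)
  d_gr_zero : ∀ x ∈ C.gr 0, C.d x = 0
  d_gr_succ : ∀ n, ∀ x ∈ C.gr (n + 1), C.d x ∈ C.gr n
  leibniz : ∀ n, ∀ x ∈ C.gr n, ∀ y : C.B,
    C.d (C.mult (tm x y)) = C.mult (tm (C.d x) y) + (-1 : ℤ) ^ n • C.mult (tm x (C.d y))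
  d_d : ∀ x, C.d (C.d x) = 0

/-- Morphisms of differential graded `S`-algebras. -/
structure DGHom (C D : DGData.{u, v} S) where
  hom : Hom C.B D.B
  map_mult : ∀ x y, hom (C.mult (tm x y)) = D.mult (tm (hom x) (hom y))
  map_gr : ∀ n, ∀ x ∈ C.gr n, hom x ∈ D.gr n
  map_d : ∀ x, hom (C.d x) = D.d (hom x)

/-- The cycles of degree `n`. -/
def DGData.cycles (C : DGData.{u, v} S) (n : ℕ) : AddSubgroup C.B := C.gr n ⊓ C.d.1.ker

/-- The boundaries of degree `n`. -/
def DGData.boundaries (C : DGData.{u, v} S) (n : ℕ) : AddSubgroup C.B :=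
  (C.gr (n + 1)).map C.d.1

/-- The homology group in degree `n`, cycles modulo boundaries. -/
abbrev DGData.homology (C : DGData.{u, v} S) (n : ℕ) : Type v :=
  ↥(C.cycles n) ⧸ (C.boundaries n).addSubgroupOf (C.cycles n)

/-- The map on cycles induced by a morphism. -/
def DGHom.cyclesMap {C D : DGData.{u, v} S} (f : DGHom C D) (n : ℕ) :
    ↥(C.cycles n) →+ ↥(D.cycles n) :=
  (f.hom.1.comp (C.cycles n).subtype).codRestrict (D.cycles n) (fun x =>
    ⟨f.map_gr n _ x.2.1, by
      have h : C.d x.1 = 0 := x.2.2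
      change D.d (f.hom x.1) = 0
      rw [← f.map_d, h, map_zero]⟩)

/-- The map on homology induced by a morphism. -/
def DGHom.homologyMap {C D : DGData.{u, v} S} (f : DGHom C D) (n : ℕ) :
    C.homology n →+ D.homology n :=
  QuotientAddGroup.map _ _ (f.cyclesMap n) (by
    rintro x ⟨y, hy, hxy⟩
    exact ⟨f.hom y, f.map_gr _ _ hy, (f.map_d y).symm.trans (congrArg f.hom.1 hxy)⟩)

/-- A quasi-isomorphism induces isomorphisms on homology in all degrees. -/
def DGHom.IsQuasiIso {C D : DGData.{u, v} S} (f : DGHom C D) : Prop :=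
  ∀ n, Function.Bijective (f.homologyMap n)

/-! ## `A_∞`-coalgebras and the cobar construction -/

/-- The data of a locally finite `A_∞`-coalgebra: a graded bimodule `K = ⨁_x piece x`, given as a
direct sum of bimodules `piece x` that are homogeneous of homological degree `deg x + 1` (so that
degrees in `K` are positive and `deg x` is the degree in `K[1]`), and a homomorphism `Δ` from `K`
to the tensor algebra of `K`, whose component in `K^{⊗ k}` is the coproduct `Δ_k`. -/
structure CoalgData (S : Type u) [Ring S] where
  X : Type
  deg : X → ℕ
  piece : X → Bimodule.{u, v} S
  Δ : Hom (sum piece) (talg (sum piece))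

namespace CoalgData

variable (K : CoalgData.{u, v} S)

/-- The underlying bimodule of `K`. -/
abbrev total : Bimodule.{u, v} S := sum K.piece

/-- The coproduct `Δ_{k+1} : K → K^{⊗ (k+1)}`. -/
def coprod (k : ℕ) : Hom K.total (pow K.total k) := (tproj K.total k).comp K.Δ

/-- The operator `x ↦ (-1)^{p m} x`, for `x` of homological degree `m` in `K`. -/
def sgn (p : ℕ) : Hom K.total K.total :=
  sumLift (fun x => (-1 : ℤ) ^ (p * (K.deg x + 1)) • incl K.piece x)

/-- The operator `x ↦ (-1)^m x`, for `x` of degree `m` in `K[1]`. -/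
def sgnShift : Hom K.total K.total :=
  sumLift (fun x => (-1 : ℤ) ^ (K.deg x) • incl K.piece x)

/-- The additive subgroup of `K^{⊗ (k+1)}` generated by the pure tensors
`x_0 ⊗ ⋯ ⊗ x_k` of homogeneous elements whose degrees in `K[1]` add up to `m`. -/
def powGr : (k m : ℕ) → AddSubgroup (pow K.total k)
  | 0, m => AddSubgroup.closure {z | ∃ (x : K.X) (y : K.piece x), K.deg x = m ∧
      z = incl K.piece x y}
  | k + 1, m => AddSubgroup.closure {z | ∃ (x : K.X) (y : K.piece x) (b : ℕ)
      (w : pow K.total k), w ∈ powGr k b ∧ K.deg x + b = m ∧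
      z = tm (M := K.total) (incl K.piece x y) w}

/-- The part of degree `m` of the tensor algebra of `K[1]`. -/
def cobarGr (m : ℕ) : AddSubgroup (talg K.total) :=
  AddSubgroup.closure {z | ∃ (k : ℕ) (w : pow K.total k), w ∈ K.powGr k m ∧
    z = tincl K.total k w}

/-- For `f : K → K^{⊗ s}` of degree congruent to `p` modulo `2`, the map
`1^{⊗ r} ⊗ f ⊗ 1^{⊗ t}` on `K^{⊗ (k+1)}`, where `r + t = k`, with the Koszul sign rule. -/
def applyAt (p : ℕ) (f : Hom K.total (talg K.total)) :
    (r k : ℕ) → Hom (pow K.total k) (talg K.total)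
  | 0, 0 => f
  | 0, k + 1 => (tmult K.total).comp (map f (tincl K.total k))
  | _ + 1, 0 => 0
  | r + 1, k + 1 => (tcons K.total).comp (map (K.sgn p) (applyAt p f r k))

/-- The laws of an `A_∞`-coalgebra: `Δ_k` maps `K_n` to the part of degree `n - 2 + k` of
`K^{⊗ k}` (so that the degree drops by one after shifting), and, for all `n ≥ 0`,
`∑_{r + s + t = n + 1} (-1)^{r + s t} (1^{⊗ r} ⊗ Δ_s ⊗ 1^{⊗ t}) ∘ Δ_{r + 1 + t} = 0`. The summation
index `q.1` is `s - 1`, and `Δ_s` has degree `s - 2`, which is congruent to `s` modulo `2`. -/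
structure IsAInfinityCoalgebra : Prop where
  deg_zero : ∀ k, ∀ x ∈ K.powGr 0 0, K.coprod k x = 0
  deg_succ : ∀ k n, ∀ x ∈ K.powGr 0 (n + 1), K.coprod k x ∈ K.powGr k n
  stasheff : ∀ (n : ℕ) (x : K.total),
    ∑ p ∈ Finset.HasAntidiagonal.antidiagonal n, ∑ q ∈ Finset.HasAntidiagonal.antidiagonal p.2,
      (-1 : ℤ) ^ (p.1 + (q.1 + 1) * q.2) •
        K.applyAt (q.1 + 1) ((tincl K.total q.1).comp (K.coprod q.1)) p.1 (p.1 + q.2)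
          (K.coprod (p.1 + q.2) x) = 0

/-- The map `[1]^{⊗ (k+1)}` on `K^{⊗ (k+1)}`. The shift is the identity on elements and has odd
degree, so the sign on `x_1 ⊗ ⋯ ⊗ x_k` is `(-1)^{∑ (k - i) m_i}`, where `m_i` is the degree of
`x_i` in `K`. -/
def shiftPow : (k : ℕ) → Hom (pow K.total k) (pow K.total k)
  | 0 => Hom.id K.total
  | k + 1 => map (K.sgn (k + 1)) (shiftPow k)

/-- The differential on generators, `d = - ∑_k [1]^{⊗ k} ∘ Δ_k ∘ [-1]`. -/
def dGen : Hom K.total (talg K.total) :=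
  -((sumLift (fun k => (tincl K.total k).comp (K.shiftPow k)) :
    Hom (talg K.total) (talg K.total)).comp K.Δ)

/-- The extension of `dGen` by the graded Leibniz rule
`d (x w) = (d x) w + (-1)^{deg x} x (d w)`, on words with `k + 1` letters. -/
def dPow : (k : ℕ) → Hom (pow K.total k) (talg K.total)
  | 0 => K.dGen
  | k + 1 => (tmult K.total).comp (map K.dGen (tincl K.total k)) +
      (tcons K.total).comp (map K.sgnShift (dPow k))

/-- The cobar construction: the tensor algebra of `K[1]` with the differential determined by
the coproducts. -/
def cobar : DGData.{u, v} S where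
  B := talg K.total
  mult := tmult K.total
  gr := K.cobarGr
  d := sumLift K.dPow

end CoalgData

/-! ## Homogeneous ideals and their quotient algebras -/

/-- A homogeneous two-sided ideal `I` of the non-unital tensor `S`-algebra of `V`, contained in the
ideal of words of length at least two. (The index `n` stands for words of length `n + 1`.) -/
structure HomogeneousIdeal (V : Bimodule.{u, v} S) extends SubBimodule (talg V) where
  mul_mem_left : ∀ (x : talg V) {y : talg V}, y ∈ toAddSubgroup →
    tmult V (tm x y) ∈ toAddSubgroup
  mul_mem_right : ∀ {x : talg V} (y : talg V), x ∈ toAddSubgroup →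
    tmult V (tm x y) ∈ toAddSubgroup
  homogeneous : ∀ {x : talg V}, x ∈ toAddSubgroup →
    ∀ n, tincl V n (tproj V n x) ∈ toAddSubgroup
  minimal : ∀ {x : talg V}, x ∈ toAddSubgroup → tproj V 0 x = 0

namespace HomogeneousIdeal

variable {V : Bimodule.{u, v} S} (I : HomogeneousIdeal V)

/-- The homogeneous component of the ideal in word length `n + 1`, as a sub-bimodule of
`V^{⊗ (n+1)}`. -/
def comp (n : ℕ) : SubBimodule (pow V n) := I.toSubBimodule.comap (tincl V n)

/-- The homogeneous component of the ideal in word length `n + 1`, as a bimodule. -/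
def R (n : ℕ) : Bimodule.{u, v} S := (I.comp n).toBimodule

/-- The inclusion of a homogeneous component into the tensor power. -/
def inclR (n : ℕ) : Hom (I.R n) (pow V n) := (I.comp n).subtype

/-- A homomorphism with values in the ideal, followed by the projection to the homogeneous
component in word length `n + 1`. -/
def toR {M : Bimodule.{u, v} S} (n : ℕ) (f : Hom M (talg V)) (h : ∀ x, f x ∈ I.toAddSubgroup) :
    Hom M (I.R n) :=
  (I.comp n).codRestrict ((tproj V n).comp f) (fun x => I.homogeneous (h x) n)

/-- The multiplication of `T(V)/I`, as a biadditive map. -/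
def quotMulAdd : (talg V ⧸ I.toAddSubgroup) →+ (talg V ⧸ I.toAddSubgroup) →+
    (talg V ⧸ I.toAddSubgroup) :=
  QuotientAddGroup.lift I.toAddSubgroup
    (AddMonoidHom.mk' (fun x => QuotientAddGroup.map I.toAddSubgroup I.toAddSubgroup
        (curry (tmult V) x) (fun _ hy => I.mul_mem_left x hy))
      (fun a b => by
        refine QuotientAddGroup.addMonoidHom_ext _ (AddMonoidHom.ext fun y => ?_)
        exact congrArg QuotientAddGroup.mk
          (DFunLike.congr_fun (map_add (curry (tmult V)) a b) y)))
    (fun x hx => by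
      refine QuotientAddGroup.addMonoidHom_ext _ (AddMonoidHom.ext fun y => ?_)
      exact (QuotientAddGroup.eq_zero_iff _).2 (I.mul_mem_right y hx))

/-- The multiplication of `A = T(V)/I`. -/
def quotMul : Hom (tensor I.quotient I.quotient) I.quotient :=
  lift (M := I.quotient) (N := I.quotient) (P := I.quotient) I.quotMulAdd
    (by
      rintro ⟨x⟩ s ⟨y⟩
      exact congrArg QuotientAddGroup.mk (curry_bal (tmult V) x s y))
    (by
      rintro s ⟨x⟩ ⟨y⟩
      exact congrArg QuotientAddGroup.mk (curry_left (tmult V) s x y))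
    (by
      rintro s ⟨x⟩ ⟨y⟩
      exact congrArg QuotientAddGroup.mk (curry_right (tmult V) s x y))

/-- The algebra `A = T(V)/I`, as a differential graded algebra concentrated in degree `0`. -/
def algebra : DGData.{u, v} S where
  B := I.quotient
  mult := I.quotMul
  gr n := if n = 0 then ⊤ else ⊥
  d := 0

theorem mult_mem {M N : Bimodule.{u, v} S} (f : Hom M (talg V)) (g : Hom N (talg V))
    (h : (∀ x, f x ∈ I.toAddSubgroup) ∨ ∀ y, g y ∈ I.toAddSubgroup) (z : tensor M N) :
    (tmult V).comp (map f g) z ∈ I.toAddSubgroup := by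
  refine (QuotientAddGroup.eq_zero_iff _).1 ?_
  refine DFunLike.congr_fun
    (f := (QuotientAddGroup.mk' I.toAddSubgroup).comp ((tmult V).comp (map f g)).1) (g := 0)
    (tensor_hom_ext fun m n => ?_) z
  refine (QuotientAddGroup.eq_zero_iff _).2 ?_
  rcases h with h | h
  · exact I.mul_mem_right (g n) (h m)
  · exact I.mul_mem_left (f m) (h n)

end HomogeneousIdeal

/-! ## Bracketings -/

mutual
/-- Closed non-degenerate bracketings: a single input, or `[β_1 ⋯ β_k]` with `k ≥ 2`, written as
the bracket around a first closed bracketing and a non-empty sequence of further ones. -/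
inductive Tree : Type
  | input : Tree
  | bracket : Tree → Forest → Tree
/-- Non-empty sequences of closed non-degenerate bracketings. -/
inductive Forest : Type
  | one : Tree → Forest
  | cons : Tree → Forest → Forest
end

/-- Whether a closed bracketing is a single input. -/
def Tree.isInput : Tree → Bool
  | .input => true
  | .bracket _ _ => false

/-- Whether a sequence consists of inputs only. -/
def Forest.flat : Forest → Bool
  | .one t => t.isInput
  | .cons t f => t.isInput && f.flat

/-- The number of entries of a sequence, minus one. -/
def Forest.len : Forest → ℕ
  | .one _ => 0
  | .cons _ f => f.len + 1

mutual
/-- The number of pairs of brackets. -/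
def Tree.brackets : Tree → ℕ
  | .input => 0
  | .bracket t f => t.brackets + f.brackets + 1
/-- The number of pairs of brackets. -/
def Forest.brackets : Forest → ℕ
  | .one t => t.brackets
  | .cons t f => t.brackets + f.brackets
end

/-- Concatenation. -/
def Forest.append : Forest → Forest → Forest
  | .one t, g => .cons t g
  | .cons t f, g => .cons t (f.append g)

theorem Forest.flat_append (f g : Forest) : (f.append g).flat = (f.flat && g.flat) := by
  match f with
  | .one t => rfl
  | .cons t f => simp [Forest.append, Forest.flat, Forest.flat_append f g, Bool.and_assoc]

/-- For `f = β_1 ⋯ β_k`, the exponent `∑ (k - i) d_i`, where `d_i`, the number of brackets of `β_i`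
plus one, is the homological degree of `β_i`. -/
def Forest.signExp : Forest → ℕ
  | .one _ => 0
  | .cons t f => (f.len + 1) * (t.brackets + 1) + f.signExp

/-- The bimodule `P` if `b` is true, and `Q` otherwise. -/
def pick (b : Bool) (P Q : Bimodule.{u, v} S) : Bimodule.{u, v} S :=
  match b with
  | true => P
  | false => Q

/-- Homomorphisms into `pick b P Q`, by cases. -/
def toPick (b : Bool) {M P Q : Bimodule.{u, v} S} (α : b = true → Hom M P)
    (β : b = false → Hom M Q) : Hom M (pick b P Q) :=
  match b, α, β with
  | true, α, _ => α rfl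
  | false, _, β => β rfl

/-- Homomorphisms out of `pick b P Q`, by cases. -/
def fromPick (b : Bool) {M P Q : Bimodule.{u, v} S} (α : b = true → Hom P M)
    (β : b = false → Hom Q M) : Hom (pick b P Q) M :=
  match b, α, β with
  | true, α, _ => α rfl
  | false, _, β => β rfl

theorem fromPick_mem (b : Bool) {M P Q : Bimodule.{u, v} S} (α : b = true → Hom P M)
    (β : b = false → Hom Q M) (N : AddSubgroup M) (hb : b = true) (h : ∀ x, α hb x ∈ N)
    (x : pick b P Q) : fromPick b α β x ∈ N := by
  subst hb
  exact h x

section Brackets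

variable {V : Bimodule.{u, v} S} (I : HomogeneousIdeal V)

mutual
/-- The bracketed tensor product `(V,I)^β`: an input contributes `V`, an innermost bracket
`[V^n]` around `n` inputs is replaced by the homogeneous component of `I` in word length `n`, and
any other bracket `[β_1 ⋯ β_k]` contributes `(V,I)^{β_1} ⊗ ⋯ ⊗ (V,I)^{β_k}`. -/
def Tree.obj : Tree → Bimodule.{u, v} S
  | .input => V
  | .bracket t f => pick (t.isInput && f.flat) (I.R (f.len + 1)) (tensor t.obj f.obj)
/-- The tensor product `(V,I)^{β_1} ⊗ ⋯ ⊗ (V,I)^{β_k}`. -/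
def Forest.obj : Forest → Bimodule.{u, v} S
  | .one t => t.obj
  | .cons t f => tensor t.obj f.obj
end

/-- The bimodule attached to a sequence when it is enclosed in a bracket: it is the homogeneous
component of `I` for a sequence of inputs, and the tensor product otherwise. For a sequence of at
least two entries, it is by definition the bimodule of the tree obtained by enclosing it. -/
def Forest.enc (f : Forest) : Bimodule.{u, v} S := pick f.flat (I.R f.len) (f.obj I)

/-- The identification of `V^{⊗ (n+1)}` with the bimodule of a sequence of `n + 1` inputs
(and zero for other sequences, where it is not used). -/
def Forest.ofRun : (f : Forest) → (n : ℕ) → Hom (pow V n) (f.obj I)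
  | .one .input, 0 => Hom.id V
  | .one .input, _ + 1 => 0
  | .one (.bracket _ _), _ => 0
  | .cons .input _, 0 => 0
  | .cons .input f, n + 1 => map (Hom.id V) (f.ofRun n)
  | .cons (.bracket _ _) _, _ => 0

/-- Removing an enclosing bracket: the inclusion of the component of `I` in the tensor power for a
sequence of inputs, and the identity otherwise. -/
def Forest.unbracket (f : Forest) : Hom (f.enc I) (f.obj I) :=
  fromPick f.flat (fun _ => (f.ofRun I f.len).comp (I.inclR f.len)) (fun _ => Hom.id _)

mutual
/-- The map to the tensor algebra forgetting all brackets. -/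
def Tree.word : (t : Tree) → Hom (t.obj I) (talg V)
  | .input => tincl V 0
  | .bracket t f => fromPick (t.isInput && f.flat)
      (fun _ => (tincl V (f.len + 1)).comp (I.inclR (f.len + 1)))
      (fun _ => (tmult V).comp (map t.word f.word))
/-- The map to the tensor algebra forgetting all brackets. -/
def Forest.word : (f : Forest) → Hom (f.obj I) (talg V)
  | .one t => t.word
  | .cons t f => (tmult V).comp (map t.word f.word)
end

/-- The map to the tensor algebra forgetting all brackets, on an enclosed sequence. -/
def Forest.encWord (f : Forest) : Hom (f.enc I) (talg V) :=
  fromPick f.flat (fun _ => (tincl V f.len).comp (I.inclR f.len)) (fun _ => f.word I)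

theorem Forest.encWord_mem (f : Forest) (h : f.flat = true) (x : f.enc I) :
    f.encWord I x ∈ I.toAddSubgroup :=
  fromPick_mem _ _ _ _ h (fun y : ↥(I.comp f.len).toAddSubgroup => y.2) x

/-- The tautological map for the concatenation of two sequences. -/
def Forest.concat : (f g : Forest) → Hom (tensor (f.obj I) (g.obj I)) ((f.append g).obj I)
  | .one t, g => Hom.id (tensor (t.obj I) (g.obj I))
  | .cons t f, g => (map (Hom.id (t.obj I)) (f.concat g)).comp
      (assoc (t.obj I) (f.obj I) (g.obj I))

/-- The map induced by removing the first bracket in `[f] g`, inside an enclosing bracket. If `f`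
and `g` consist of inputs, it is the multiplication `R_m ⊗ V^n → R_{m+n}`, otherwise it is the
tautological map, preceded by the inclusion `R_m ⊆ V^m` if `f` consists of inputs. -/
def Forest.concatEnc (f g : Forest) :
    Hom (tensor (f.enc I) (g.obj I)) ((f.append g).enc I) :=
  toPick (f.append g).flat
    (fun h => I.toR (f.append g).len ((tmult V).comp (map (f.encWord I) (g.word I)))
      (I.mult_mem _ _ (Or.inl (f.encWord_mem I (by
        rw [Forest.flat_append, Bool.and_eq_true] at h; exact h.1)))))
    (fun _ => (f.concat I g).comp (map (f.unbracket I) (Hom.id (g.obj I))))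

/-- The map `(V,I)^t ⊗ (V,I)^{[g]} → (V,I)^{[t g]}` moving `t` inside a bracket. If `t` and `g`
consist of inputs, it is the multiplication `V ⊗ R_n → R_{n+1}`, otherwise it is the tautological
map, preceded by the inclusion `R_n ⊆ V^n` if `g` consists of inputs. -/
def Forest.consEnc (t : Tree) (g : Forest) :
    Hom (tensor (t.obj I) (g.enc I)) ((Forest.cons t g).enc I) :=
  toPick (t.isInput && g.flat)
    (fun h => I.toR (g.len + 1) ((tmult V).comp (map (t.word I) (g.encWord I)))
      (I.mult_mem _ _ (Or.inr (g.encWord_mem I (by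
        rw [Bool.and_eq_true] at h; exact h.2)))))
    (fun _ => map (Hom.id (t.obj I)) (g.unbracket I))

/-- The identity map for sequences that contain a bracket (and zero for sequences of inputs, where
it is not used). -/
def Forest.toEnc (f : Forest) : Hom (f.obj I) (f.enc I) :=
  toPick f.flat (fun _ => 0) (fun _ => Hom.id _)

/-- The direct sum of all `(V,I)^β` over closed bracketings `β`. -/
abbrev trees : Bimodule.{u, v} S := sum (fun t : Tree => t.obj I)

/-- The direct sum of the bimodules of all enclosed sequences. -/
abbrev forests : Bimodule.{u, v} S := sum (fun f : Forest => f.enc I)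

/-- The inclusion of the summand of a tree. -/
abbrev inTrees (t : Tree) : Hom (t.obj I) (trees I) := incl (fun t : Tree => t.obj I) t

/-- The inclusion of the summand of an enclosed sequence. -/
abbrev inForests (f : Forest) : Hom (f.enc I) (forests I) := incl (fun f : Forest => f.enc I) f

/-- Enclosing sequences with at least two entries in a bracket. -/
def close : Hom (forests I) (trees I) :=
  sumLift (fun f => match f with
    | .one _ => 0
    | .cons t f => inTrees I (.bracket t f))

/-- Removing the outer bracket of `t`. -/
def dropOne : (t : Tree) → Hom (t.obj I) (forests I)
  | .input => 0
  | .bracket a c => inForests I (.cons a c)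

/-- Removing the outer bracket of `t` in the sequence `t f`. -/
def dropCons : (t : Tree) → (f : Forest) → Hom (tensor (t.obj I) (f.obj I)) (forests I)
  | .input, _ => 0
  | .bracket a c, f => (inForests I ((Forest.cons a c).append f)).comp
      ((Forest.cons a c).concatEnc I f)

/-- The signed sum over the removals of all brackets in the one-entry sequence `t`, where `δt` is
the signed sum over the removals of the internal brackets of `t`. -/
def stepOne (t : Tree) (δt : Hom (t.obj I) (trees I)) : Hom (t.obj I) (forests I) :=
  dropOne I t -
    (sumLift (fun t₁ => (inForests I (.one t₁)).comp ((Forest.one t₁).toEnc I)) :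
      Hom (trees I) (forests I)).comp δt

/-- The signed sum over the removals of all brackets in the sequence `t f`, where `δt` is the
signed sum over the removals of the internal brackets of `t` and `δf` is the signed sum over the
removals of all brackets in `f`. The left brackets in `t f` are, from left to right, the outer
bracket of `t`, the internal brackets of `t`, and the brackets in `f`. -/
def stepCons (t : Tree) (f : Forest) (δt : Hom (t.obj I) (trees I))
    (δf : Hom (f.obj I) (forests I)) : Hom (tensor (t.obj I) (f.obj I)) (forests I) :=
  dropCons I t f -
    (sumTensorLift (fun t₁ => (inForests I (.cons t₁ f)).comp ((Forest.cons t₁ f).toEnc I)) :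
      Hom (tensor (trees I) (f.obj I)) (forests I)).comp (map δt (Hom.id (f.obj I))) +
    (-1 : ℤ) ^ t.brackets •
      (tensorSumLift (fun g => (inForests I (.cons t g)).comp (Forest.consEnc I t g)) :
        Hom (tensor (t.obj I) (forests I)) (forests I)).comp (map (Hom.id (t.obj I)) δf)

mutual
/-- The sum, over the internal left brackets of a closed bracketing, of `(-1)^{m-1}` times the map
induced by removing the `m`-th internal left bracket, counted from the left, together with its
matching right bracket. -/
def Tree.delta : (t : Tree) → Hom (t.obj I) (trees I)
  | .input => 0
  | .bracket t f => (close I).comp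
      (fromPick (t.isInput && f.flat) (fun _ => 0) (fun _ => stepCons I t f t.delta f.delta))
/-- The sum, over the left brackets of a sequence, of `(-1)^{m-1}` times the map induced by
removing the `m`-th left bracket, counted from the left, together with its matching right
bracket; the resulting sequences are taken inside an enclosing bracket. -/
def Forest.delta : (f : Forest) → Hom (f.obj I) (forests I)
  | .one t => stepOne I t t.delta
  | .cons t f => stepCons I t f t.delta f.delta
end

/-- The tautological map `(V,I)^{β_1} ⊗ ⋯ ⊗ (V,I)^{β_k} → K^{⊗ k}`, where `K` is the direct sum of
all `(V,I)^β`. -/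
def Forest.split : (f : Forest) → Hom (f.obj I) (talg (trees I))
  | .one t => (tincl (trees I) 0).comp (inTrees I t)
  | .cons t f => (tcons (trees I)).comp (map (inTrees I t) f.split)

/-- All coproducts on `(V,I)^β`: `Δ_1` removes internal brackets, and, for `β = [β_1 ⋯ β_k]`, the
coproduct `Δ_k` removes the outer bracket, with sign `-(-1)^{∑ (k - i) d_i}`. -/
def Tree.coproducts : (t : Tree) → Hom (t.obj I) (talg (trees I))
  | .input => 0
  | .bracket t f => (tincl (trees I) 0).comp (Tree.delta I (.bracket t f)) -
      (-1 : ℤ) ^ (Forest.cons t f).signExp •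
        ((Forest.split I (.cons t f)).comp (Forest.unbracket I (.cons t f)) :
          Hom (Tree.obj I (.bracket t f)) (talg (trees I)))

/-- The `A_∞`-coalgebra `B^∞(V,I) = ⨁_β (V,I)^β`, with `(V,I)^β` in homological degree one more
than the number of pairs of brackets of `β`. -/
def Binfinity : CoalgData.{u, v} S where
  X := Tree
  deg := Tree.brackets
  piece := fun t => t.obj I
  Δ := sumLift (fun t => t.coproducts I)

/-- The inclusion of the generators `V` into the cobar construction of `B^∞(V,I)`. -/
def generator : Hom V (Binfinity I).cobar.B :=
  (tincl (trees I) 0).comp (inTrees I Tree.input)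

end Brackets

end BracketCobar

end

/-!
The cobar algebra `C = T_S(B^∞(V,I)[1])` is the direct sum, over all non-empty sequences of closed
bracketings, of the bimodules of these sequences (`Forest.split`, with inverse `toSequences`), and
on each summand its differential is the signed sum over the removals of all brackets
(`cobarD_split`).

Let `E = forests I` be the sum of the bimodules of sequences enclosed in one more bracket.
Removing that bracket is a map `unwrap : E → C`, compatible with multiplication from both sides
(`unwrap_concatEnc`, `unwrap_consEnc`). On the summand of a sequence which contains a bracket it
is an identity map, and on a sequence of `n` inputs it is the inclusion of the component `R_n` of
the ideal in `V^{⊗ n}`. Hence it is injective (`unwrap_injective`), without any flatness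
assumption, although the maps `R_n ⊗ V → V^{⊗ (n+1)}` need not be; all commutativity statements
for the structure maps can therefore be checked in `C`. In particular, `d² = 0` on a tree reduces
to `d² = 0` on the sequence inside its outer bracket (`cobarD_cobarD_split`).

The Stasheff identities are the components of `d² = 0` in the tensor powers, up to the signs of
the shift: conjugation by `[1]^{⊗ k}` turns `1^{⊗ r} ⊗ Δ_s ⊗ 1^{⊗ t}` into the corresponding
summand of the differential, up to the sign `(-1)^{r + s t}` (`CoalgData.shift_applyAt`).

For the quasi-isomorphism, enclosing a sequence with at least two entries, not all of them inputs,
in a new outer bracket defines a homotopy `h` with `d h + h d = 1` in degrees at least two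
(`homotopy_add_of_two_le`). In degree one, the difference between the two sides consists of
elements of the ideal in an innermost bracket, on which `d` is the injective map to the tensor
algebra of `V` (`exists_homotopy_add_of_one`). Hence cycles of positive degree are boundaries. In
degree zero, `C` is the tensor algebra of `V`, and the boundaries form the ideal.
-/

namespace BracketCobar

noncomputable section

variable {S : Type u} [Ring S]

/-! ### Elementwise rules for bimodules, tensor products and direct sums -/

section Basics

variable {M N P Q : Bimodule.{u, v} S}

@[simp] theorem Hom.id_apply (x : M) : (Hom.id M).1 x = x := rfl

@[simp] theorem Hom.comp_apply (g : Hom N P) (f : Hom M N) (x : M) :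
    (g.comp f).1 x = g.1 (f.1 x) := rfl

@[simp] theorem Hom.add_apply (f g : Hom M N) (x : M) : (f + g).1 x = f.1 x + g.1 x := rfl

@[simp] theorem Hom.sub_apply (f g : Hom M N) (x : M) : (f - g).1 x = f.1 x - g.1 x := rfl

@[simp] theorem Hom.zsmul_apply (n : ℤ) (f : Hom M N) (x : M) : (n • f).1 x = n • f.1 x := rfl

theorem tensor_induction {p : tensor M N → Prop} (tm : ∀ m n, p (tm m n))
    (add : ∀ x y, p x → p y → p (x + y)) (z : tensor M N) : p z := by
  obtain ⟨z, rfl⟩ := QuotientAddGroup.mk_surjective z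
  induction z with
  | zero => exact (congrArg p (map_zero (tmul M N 0))).mp (tm 0 0)
  | tmul m n => exact tm m n
  | add x y hx hy => exact add _ _ hx hy

theorem tm_add (m : M) (n n' : N) : tm m (n + n') = tm m n + tm m n' :=
  map_add (tmul M N m) n n'

theorem add_tm (m m' : M) (n : N) : tm (m + m') n = tm m n + tm m' n :=
  DFunLike.congr_fun (map_add (tmul M N) m m') n

@[simp] theorem tm_zero (m : M) : tm m (0 : N) = 0 := map_zero (tmul M N m)

@[simp] theorem zero_tm (n : N) : tm (0 : M) n = 0 :=
  DFunLike.congr_fun (map_zero (tmul M N)) n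

theorem tm_neg (m : M) (n : N) : tm m (-n) = -tm m n := map_neg (tmul M N m) n

theorem neg_tm (m : M) (n : N) : tm (-m) n = -tm m n :=
  DFunLike.congr_fun (map_neg (tmul M N) m) n

@[simp] theorem map_tm {M' N' : Bimodule.{u, v} S} (f : Hom M M') (g : Hom N N') (m : M) (n : N) :
    (map f g).1 (tm m n) = tm (f.1 m) (g.1 n) := rfl

open scoped Classical in
theorem sum_induction {ι : Type} {M : ι → Bimodule.{u, v} S} {p : sum M → Prop}
    (zero : p 0) (incl : ∀ i m, p (incl M i m)) (add : ∀ x y, p x → p y → p (x + y))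
    (z : sum M) : p z := by
  exact DirectSum.induction_on (β := fun i => (M i : Type v)) z zero incl add

section Sum

variable {ι : Type} {M : ι → Bimodule.{u, v} S}

open scoped Classical in
@[simp] theorem sumLift_incl (F : ∀ i, Hom (M i) P) (i : ι) (m : M i) :
    (sumLift F).1 ((incl M i).1 m) = (F i).1 m :=
  DirectSum.toAddMonoid_of _ _ _

open scoped Classical in
@[simp] theorem proj_incl (i : ι) (m : M i) : (proj M i).1 ((incl M i).1 m) = m :=
  DirectSum.of_eq_same (β := fun i => (M i : Type v)) _ _

open scoped Classical in
theorem proj_incl_ne {i j : ι} (h : i ≠ j) (m : M i) : (proj M j).1 ((incl M i).1 m) = 0 :=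
  DirectSum.of_eq_of_ne (β := fun i => (M i : Type v)) _ _ _ h.symm

open scoped Classical in
@[simp] theorem sumTensorLift_tm_incl (F : ∀ i, Hom (tensor (M i) N) P) (i : ι) (m : M i) (n : N) :
    (sumTensorLift F).1 (tm ((incl M i).1 m) n) = (F i).1 (tm m n) :=
  DFunLike.congr_fun (DirectSum.toAddMonoid_of (fun i => curry (F i)) i m) n

open scoped Classical in
@[simp] theorem tensorSumLift_tm_incl (F : ∀ i, Hom (tensor N (M i)) P) (i : ι) (n : N) (m : M i) :
    (tensorSumLift F).1 (tm n ((incl M i).1 m)) = (F i).1 (tm n m) :=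
  DFunLike.congr_fun (DirectSum.toAddMonoid_of (fun i => (curry (F i)).flip) i m) n

/-- An element of a direct sum is determined by its components. -/
theorem sum_ext {x y : sum M} (h : ∀ i, proj M i x = proj M i y) : x = y :=
  DFinsupp.ext h

end Sum

/-! ### The tensor algebra as a non-unital ring -/

/-- Words with one letter. -/
def letter (M : Bimodule.{u, v} S) : Hom M (talg M) := tincl M 0

/-- The pure tensor `a ⊗ w`, as an element of a tensor power. -/
def powCons {n : ℕ} (a : M) (w : pow M n) : pow M (n + 1) := tm a w

theorem pow_succ_induction {n : ℕ} {p : pow M (n + 1) → Prop} (cons : ∀ a w, p (powCons a w))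
    (add : ∀ x y, p x → p y → p (x + y)) (z : pow M (n + 1)) : p z :=
  tensor_induction (p := p) cons add z

theorem tcons_tm_tincl (n : ℕ) (a : M) (w : pow M n) :
    (tcons M).1 (tm a ((tincl M n).1 w)) = (tincl M (n + 1)).1 (powCons a w) :=
  tensorSumLift_tm_incl _ _ _ _

theorem tmult_tm_letter (a : M) (w : talg M) :
    (tmult M).1 (tm ((letter M).1 a) w) = (tcons M).1 (tm a w) :=
  sumTensorLift_tm_incl _ _ _ _

theorem tmult_tm_tcons (a : M) (x y : talg M) :
    (tmult M).1 (tm ((tcons M).1 (tm a x)) y) = (tcons M).1 (tm a ((tmult M).1 (tm x y))) := by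
  induction x using sum_induction with
  | zero => simp only [tm_zero, map_zero, zero_tm]
  | incl n w =>
    rw [tcons_tm_tincl]
    exact (sumTensorLift_tm_incl _ _ _ _).trans
      (congrArg (fun z => (tcons M).1 (tm a z)) (sumTensorLift_tm_incl _ _ _ _).symm)
  | add x x' hx hx' => simp only [tm_add, map_add, add_tm, hx, hx']

theorem talg_induction_tcons {p : talg M → Prop} (letter : ∀ a, p ((letter M).1 a))
    (cons : ∀ a w, p w → p ((tcons M).1 (tm a w))) (add : ∀ x y, p x → p y → p (x + y))
    (z : talg M) : p z := by
  induction z using sum_induction with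
  | zero => exact (congrArg p (map_zero _)).mp (letter 0)
  | add x y hx hy => exact add x y hx hy
  | incl n w =>
    induction n with
    | zero => exact letter w
    | succ n ih =>
      induction w using pow_succ_induction with
      | cons a w =>
        rw [← tcons_tm_tincl]
        exact cons a _ (ih w)
      | add x y hx hy => rw [map_add]; exact add _ _ hx hy

/-- Concatenation of words makes the tensor algebra a non-unital ring. -/
instance : NonUnitalRing (talg M) :=
  { (talg M).addCommGroup with
    mul := fun x y => (tmult M).1 (tm x y)
    left_distrib := fun x y z => (congrArg (tmult M).1 (tm_add x y z)).trans (map_add _ _ _)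
    right_distrib := fun x y z => (congrArg (tmult M).1 (add_tm x y z)).trans (map_add _ _ _)
    zero_mul := fun x => (congrArg (tmult M).1 (zero_tm x)).trans (map_zero _)
    mul_zero := fun x => (congrArg (tmult M).1 (tm_zero x)).trans (map_zero _)
    mul_assoc := fun x y z => by
      change (tmult M).1 (tm ((tmult M).1 (tm x y)) z) = (tmult M).1 (tm x ((tmult M).1 (tm y z)))
      induction x using talg_induction_tcons with
      | letter a => simp only [tmult_tm_letter, tmult_tm_tcons]
      | cons a w ih => simp only [tmult_tm_tcons, ih]
      | add x x' hx hx' => simp only [add_tm, map_add, hx, hx'] }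

theorem tcons_tm (a : M) (w : talg M) : (tcons M).1 (tm a w) = (letter M).1 a * w :=
  (tmult_tm_letter a w).symm

theorem tincl_powCons {n : ℕ} (a : M) (w : pow M n) :
    (tincl M (n + 1)).1 (powCons a w) = (letter M).1 a * (tincl M n).1 w := by
  rw [← tcons_tm, tcons_tm_tincl]

/-- Every element of the tensor algebra is a sum of words, which arise from letters by
multiplication from the left by letters. -/
theorem talg_induction {p : talg M → Prop} (letter : ∀ a, p ((letter M).1 a))
    (cons : ∀ a w, p w → p ((BracketCobar.letter M).1 a * w))
    (add : ∀ x y, p x → p y → p (x + y)) (z : talg M) : p z :=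
  talg_induction_tcons letter (fun a w h => tcons_tm a w ▸ cons a w h) add z

theorem exists_tincl_mul (m n : ℕ) (x : pow M m) (y : pow M n) :
    ∃ z, (tincl M m).1 x * (tincl M n).1 y = (tincl M (n + m + 1)).1 z := by
  induction m with
  | zero => exact ⟨powCons (M := M) x y, (tincl_powCons (M := M) x y).symm⟩
  | succ m ih =>
    induction x using pow_succ_induction with
    | cons a w =>
      obtain ⟨z, hz⟩ := ih w
      refine ⟨powCons a z, ?_⟩
      rw [tincl_powCons, mul_assoc, hz]
      exact (tincl_powCons a z).symm
    | add x x' hx hx' =>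
      obtain ⟨z, hz⟩ := hx
      obtain ⟨z', hz'⟩ := hx'
      exact ⟨z + z', by rw [map_add, add_mul, hz, hz', map_add]⟩

/-- The map of tensor powers induced by a homomorphism. -/
def powMap (g : Hom M N) : (n : ℕ) → Hom (pow M n) (pow N n)
  | 0 => g
  | n + 1 => map g (powMap g n)

/-- The map of tensor algebras induced by a homomorphism. -/
def talgMap (g : Hom M N) : Hom (talg M) (talg N) :=
  sumLift (fun n => (tincl N n).comp (powMap g n))

theorem talgMap_tincl (g : Hom M N) (n : ℕ) (w : pow M n) :
    (talgMap g).1 ((tincl M n).1 w) = (tincl N n).1 ((powMap g n).1 w) :=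
  sumLift_incl _ _ _

theorem talgMap_letter (g : Hom M N) (a : M) :
    (talgMap g).1 ((letter M).1 a) = (letter N).1 (g.1 a) :=
  sumLift_incl _ _ _

theorem talgMap_letter_mul (g : Hom M N) (a : M) (w : talg M) :
    (talgMap g).1 ((letter M).1 a * w) = (letter N).1 (g.1 a) * (talgMap g).1 w := by
  induction w using sum_induction with
  | zero => simp
  | incl n w =>
    rw [← tincl_powCons, talgMap_tincl, talgMap_tincl, ← tincl_powCons]
    rfl
  | add x y hx hy => rw [mul_add, map_add, hx, hy, map_add, mul_add]

theorem talgMap_mul (g : Hom M N) (x y : talg M) :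
    (talgMap g).1 (x * y) = (talgMap g).1 x * (talgMap g).1 y := by
  induction x using talg_induction with
  | letter a => rw [talgMap_letter_mul, talgMap_letter]
  | cons a w ih => rw [mul_assoc, talgMap_letter_mul, ih, talgMap_letter_mul, mul_assoc]
  | add x x' hx hx' => rw [add_mul, map_add, hx, hx', map_add, add_mul]

end Basics

/-! ### Elements of `pick` -/

section Pick

variable {M P Q : Bimodule.{u, v} S} {b : Bool}

/-- The identification of `P` with `pick b P Q` if `b` is true. -/
def pickTrue (h : b = true) (x : P) : pick b P Q :=
  (toPick b (fun _ => Hom.id P) (fun h' => absurd (h.symm.trans h') (by simp))).1 x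

/-- The identification of `Q` with `pick b P Q` if `b` is false. -/
def pickFalse (h : b = false) (x : Q) : pick b P Q :=
  (toPick b (fun h' => absurd (h.symm.trans h') (by simp)) (fun _ => Hom.id Q)).1 x

theorem pick_cases {p : pick b P Q → Prop}
    (isTrue : ∀ (h : b = true) (x : P), p (pickTrue h x))
    (isFalse : ∀ (h : b = false) (x : Q), p (pickFalse h x))
    (x : pick b P Q) : p x := by
  cases b with
  | true => exact isTrue rfl x
  | false => exact isFalse rfl x

@[simp] theorem fromPick_pickTrue (α : b = true → Hom P M) (β : b = false → Hom Q M)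
    (h : b = true) (x : P) : (fromPick b α β).1 (pickTrue h x) = (α h).1 x := by
  subst h; rfl

@[simp] theorem fromPick_pickFalse (α : b = true → Hom P M) (β : b = false → Hom Q M)
    (h : b = false) (x : Q) : (fromPick b α β).1 (pickFalse h x) = (β h).1 x := by
  subst h; rfl

theorem toPick_of_true (α : b = true → Hom M P) (β : b = false → Hom M Q)
    (h : b = true) (x : M) : (toPick b α β).1 x = pickTrue h ((α h).1 x) := by
  subst h; rfl

theorem toPick_of_false (α : b = true → Hom M P) (β : b = false → Hom M Q)
    (h : b = false) (x : M) : (toPick b α β).1 x = pickFalse h ((β h).1 x) := by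
  subst h; rfl

end Pick

/-! ### Combinatorics of bracketings -/

theorem Forest.len_append (f g : Forest) : (f.append g).len = g.len + f.len + 1 := by
  match f with
  | .one t => rfl
  | .cons t f => simp only [Forest.append, Forest.len, Forest.len_append f g]; omega

theorem Forest.brackets_append (f g : Forest) :
    (f.append g).brackets = f.brackets + g.brackets := by
  match f with
  | .one t => rfl
  | .cons t f =>
    simp only [Forest.append, Forest.brackets, Forest.brackets_append f g]; omega

theorem Tree.isInput_iff (t : Tree) : t.isInput = true ↔ t.brackets = 0 := by
  cases t <;> simp [Tree.isInput, Tree.brackets]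

theorem Forest.flat_iff (f : Forest) : f.flat = true ↔ f.brackets = 0 := by
  match f with
  | .one t => simp [Forest.flat, Forest.brackets, Tree.isInput_iff]
  | .cons t f => simp [Forest.flat, Forest.brackets, Tree.isInput_iff, Forest.flat_iff f]

section Brackets

variable {V : Bimodule.{u, v} S} (I : HomogeneousIdeal V)

/-! ### Elements of the bimodules of bracketings -/

variable {I}

/-- An element of `(V,I)^t`, as an element of the bimodule of the one-entry sequence `t`. -/
def Forest.single {t : Tree} (x : t.obj I) : (Forest.one t).obj I := x

/-- The pure tensor `x ⊗ w` in the bimodule of the sequence `t f`. -/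
def Forest.consTm {t : Tree} {f : Forest} (x : t.obj I) (w : f.obj I) : (Forest.cons t f).obj I :=
  tm x w

theorem Forest.cons_induction {t : Tree} {f : Forest} {p : (Forest.cons t f).obj I → Prop}
    (cons : ∀ x w, p (Forest.consTm x w)) (add : ∀ x y, p x → p y → p (x + y))
    (z : (Forest.cons t f).obj I) : p z :=
  tensor_induction (p := p) cons add z

/-- An element of the ideal, as an element of the bimodule of an enclosed sequence of inputs. -/
def Forest.encFlat {f : Forest} (h : f.flat = true) (r : I.R f.len) : f.enc I := pickTrue h r

/-- An element of the bimodule of a sequence that contains a bracket, as an element of the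
bimodule of the enclosed sequence. -/
def Forest.encNonflat {f : Forest} (h : f.flat = false) (w : f.obj I) : f.enc I := pickFalse h w

theorem Forest.enc_cases {f : Forest} {p : f.enc I → Prop}
    (flat : ∀ h r, p (Forest.encFlat h r)) (nonflat : ∀ h w, p (Forest.encNonflat h w))
    (e : f.enc I) : p e :=
  pick_cases (p := p) flat nonflat e

@[simp] theorem Forest.unbracket_encFlat {f : Forest} (h : f.flat = true) (r : I.R f.len) :
    (f.unbracket I).1 (Forest.encFlat h r) = (f.ofRun I f.len).1 ((I.inclR f.len).1 r) :=
  fromPick_pickTrue _ _ h r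

@[simp] theorem Forest.unbracket_encNonflat {f : Forest} (h : f.flat = false) (w : f.obj I) :
    (f.unbracket I).1 (Forest.encNonflat h w) = w :=
  fromPick_pickFalse _ _ h w

theorem Forest.encWord_encFlat {f : Forest} (h : f.flat = true) (r : I.R f.len) :
    (f.encWord I).1 (Forest.encFlat h r) = (tincl V f.len).1 ((I.inclR f.len).1 r) :=
  fromPick_pickTrue _ _ h r

theorem Forest.toEnc_of_flat {f : Forest} (h : f.flat = true) (w : f.obj I) :
    (f.toEnc I).1 w = 0 :=
  (toPick_of_true _ _ h w).trans
    (map_zero (toPick f.flat (fun _ => Hom.id _) (fun h' => absurd (h.symm.trans h') (by simp))).1)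

theorem Forest.toEnc_of_nonflat {f : Forest} (h : f.flat = false) (w : f.obj I) :
    (f.toEnc I).1 w = Forest.encNonflat h w :=
  toPick_of_false _ _ h w

/-- An element of the bimodule of an enclosed sequence with at least two entries, as an element of
the bimodule of a tree. -/
def Tree.enclose {t : Tree} {f : Forest} (e : (Forest.cons t f).enc I) :
    (Tree.bracket t f).obj I := e

theorem Tree.enclose_cases {t : Tree} {f : Forest} {p : (Tree.bracket t f).obj I → Prop}
    (h : ∀ e, p (Tree.enclose e)) (x : (Tree.bracket t f).obj I) : p x := h x

variable (I)

theorem close_inForests_cons {t : Tree} {f : Forest} (e : (Forest.cons t f).enc I) :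
    (close I).1 ((inForests I (.cons t f)).1 e) = (inTrees I (.bracket t f)).1 (Tree.enclose e) :=
  sumLift_incl _ _ _

theorem close_inForests_one {t : Tree} (e : (Forest.one t).enc I) :
    (close I).1 ((inForests I (.one t)).1 e) = 0 :=
  sumLift_incl _ _ _

theorem dropOne_enclose {t : Tree} {f : Forest} (e : (Forest.cons t f).enc I) :
    (dropOne I (.bracket t f)).1 (Tree.enclose e) = (inForests I (.cons t f)).1 e := rfl

/-! ### The cobar algebra as a direct sum over sequences of bracketings -/

theorem split_single {t : Tree} (x : t.obj I) :
    (Forest.split I (.one t)).1 (Forest.single x) = (letter (trees I)).1 ((inTrees I t).1 x) := rfl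

theorem split_consTm {t : Tree} {f : Forest} (x : t.obj I) (w : f.obj I) :
    (Forest.split I (.cons t f)).1 (Forest.consTm x w) =
      (letter (trees I)).1 ((inTrees I t).1 x) * (Forest.split I f).1 w :=
  tcons_tm _ _

/-- The direct sum of the bimodules of all sequences of bracketings. -/
abbrev sequences : Bimodule.{u, v} S := sum (fun f : Forest => f.obj I)

/-- The inclusion of the summand of a sequence. -/
abbrev inSequences (f : Forest) : Hom (f.obj I) (sequences I) := incl (fun f : Forest => f.obj I) f

/-- Adding a first entry to a sequence. -/
def consSequences : Hom (tensor (trees I) (sequences I)) (sequences I) :=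
  sumTensorLift (fun t => tensorSumLift (fun f => inSequences I (.cons t f)))

/-- The decomposition of a tensor power of `⨁_β (V,I)^β` into the bimodules of sequences. -/
def powToSequences : (n : ℕ) → Hom (pow (trees I) n) (sequences I)
  | 0 => sumLift (fun t => inSequences I (.one t))
  | n + 1 => (consSequences I).comp (map (Hom.id (trees I)) (powToSequences n))

/-- The decomposition of the tensor algebra of `⨁_β (V,I)^β` into the bimodules of sequences, the
inverse of the maps `Forest.split`. -/
def toSequences : Hom (talg (trees I)) (sequences I) := sumLift (powToSequences I)

theorem toSequences_letter (t : Tree) (x : t.obj I) :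
    (toSequences I).1 ((letter (trees I)).1 ((inTrees I t).1 x)) =
      (inSequences I (.one t)).1 (Forest.single x) :=
  (sumLift_incl _ _ _).trans (sumLift_incl _ _ _)

theorem toSequences_letter_mul (a : trees I) (w : talg (trees I)) :
    (toSequences I).1 ((letter (trees I)).1 a * w) =
      (consSequences I).1 (tm a ((toSequences I).1 w)) := by
  induction w using sum_induction with
  | zero => simp
  | incl n w =>
    rw [← tincl_powCons]
    exact (sumLift_incl _ _ _).trans
      (congrArg (fun z => (consSequences I).1 (tm a z)) (sumLift_incl _ _ _).symm)
  | add x y hx hy => rw [mul_add, map_add, hx, hy, map_add, tm_add, map_add]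

theorem consSequences_tm {t : Tree} {f : Forest} (x : t.obj I) (w : f.obj I) :
    (consSequences I).1 (tm ((inTrees I t).1 x) ((inSequences I f).1 w)) =
      (inSequences I (.cons t f)).1 (Forest.consTm x w) :=
  (sumTensorLift_tm_incl _ _ _ _).trans (tensorSumLift_tm_incl _ _ _ _)

theorem toSequences_split (f : Forest) (w : f.obj I) :
    (toSequences I).1 ((f.split I).1 w) = (inSequences I f).1 w := by
  match f with
  | .one t => exact toSequences_letter I t w
  | .cons t f =>
    induction w using Forest.cons_induction with
    | cons x w => rw [split_consTm, toSequences_letter_mul, toSequences_split f, consSequences_tm]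
    | add x y hx hy => simp only [map_add, hx, hy]

theorem split_injective (f : Forest) (w : f.obj I) (h : (f.split I).1 w = 0) : w = 0 := by
  have := congrArg (fun z => (proj _ f).1 ((toSequences I).1 z)) h
  simpa only [toSequences_split, proj_incl, map_zero] using this

/-- Every element of the cobar algebra is a sum of elements of the summands of sequences. -/
theorem split_induction {p : talg (trees I) → Prop} (split : ∀ f w, p ((Forest.split I f).1 w))
    (add : ∀ x y, p x → p y → p (x + y)) (z : talg (trees I)) : p z := by
  have h0 : p 0 := (congrArg p (map_zero _)).mp (split (.one .input) 0)
  have key : z ∈ AddSubmonoid.closure {y | ∃ f w, y = (Forest.split I f).1 w} := by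
    induction z using talg_induction with
    | letter a =>
      induction a using sum_induction with
      | zero => rw [map_zero]; exact zero_mem _
      | incl t x => exact AddSubmonoid.subset_closure ⟨.one t, x, rfl⟩
      | add x y hx hy => rw [map_add]; exact add_mem hx hy
    | cons a w hw =>
      induction hw using AddSubmonoid.closure_induction with
      | mem y hy =>
        obtain ⟨f, w, rfl⟩ := hy
        induction a using sum_induction with
        | zero => rw [map_zero, zero_mul]; exact zero_mem _
        | incl t x =>
          exact AddSubmonoid.subset_closure
            ⟨.cons t f, Forest.consTm x w, (split_consTm I x w).symm⟩
        | add x y hx hy => rw [map_add, add_mul]; exact add_mem hx hy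
      | zero => rw [mul_zero]; exact zero_mem _
      | add x y _ _ hx hy => rw [mul_add]; exact add_mem hx hy
    | add x y hx hy => exact add_mem hx hy
  induction key using AddSubmonoid.closure_induction with
  | mem y hy => obtain ⟨f, w, rfl⟩ := hy; exact split f w
  | zero => exact h0
  | add x y _ _ hx hy => exact add x y hx hy

theorem split_concat (f g : Forest) (w : f.obj I) (w' : g.obj I) :
    ((f.append g).split I).1 ((f.concat I g).1 (tm w w')) = (f.split I).1 w * (g.split I).1 w' := by
  match f with
  | .one t => exact tcons_tm _ _
  | .cons t f =>
    induction w using Forest.cons_induction with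
    | cons x w =>
      rw [split_consTm, mul_assoc, ← split_concat f g w w']
      exact split_consTm I x ((f.concat I g).1 (tm w w'))
    | add x y hx hy => rw [add_tm, map_add, map_add, hx, hy, map_add, add_mul]

/-! ### Enclosed sequences inside the cobar algebra -/

/-- The letters `V` of the cobar algebra. -/
def inputs : Hom V (trees I) := inTrees I .input

/-- The inclusion of the tensor algebra of `V` in the cobar algebra, as the part of degree zero. -/
def wordsIn : Hom (talg V) (talg (trees I)) := talgMap (inputs I)

/-- Removing the enclosing brackets. This identifies the direct sum of the bimodules of all enclosed
sequences with a two-sided ideal of the cobar algebra. -/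
def unwrap : Hom (forests I) (talg (trees I)) :=
  sumLift (fun f => (f.split I).comp (f.unbracket I))

theorem unwrap_inForests (f : Forest) (e : f.enc I) :
    (unwrap I).1 ((inForests I f).1 e) = (f.split I).1 ((f.unbracket I).1 e) :=
  sumLift_incl _ _ _

theorem unwrap_encNonflat {f : Forest} (h : f.flat = false) (w : f.obj I) :
    (unwrap I).1 ((inForests I f).1 (Forest.encNonflat h w)) = (f.split I).1 w := by
  rw [unwrap_inForests, Forest.unbracket_encNonflat]

theorem split_ofRun (f : Forest) (h : f.flat = true) (z : pow V f.len) :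
    (f.split I).1 ((f.ofRun I f.len).1 z) = (wordsIn I).1 ((tincl V f.len).1 z) := by
  match f, h with
  | .one .input, _ => exact (talgMap_letter (inputs I) z).symm
  | .cons .input f, h =>
    let F : Hom (pow V (f.len + 1)) (talg (trees I)) :=
      (Forest.split I (.cons .input f)).comp (Forest.ofRun I (.cons .input f) (f.len + 1))
    change F.1 z = ((wordsIn I).comp (tincl V (f.len + 1))).1 z
    induction z using pow_succ_induction with
    | cons a z =>
      refine Eq.trans ?_ (congrArg (wordsIn I).1 (tincl_powCons a z).symm)
      refine Eq.trans ?_ (talgMap_letter_mul (inputs I) _ _).symm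
      refine Eq.trans ?_ (congrArg _
        (split_ofRun f (by simpa [Forest.flat, Tree.isInput] using h) z))
      exact split_consTm I (t := .input) _ _
    | add x y hx hy => rw [map_add, map_add, hx, hy]

theorem unwrap_encFlat {f : Forest} (h : f.flat = true) (r : I.R f.len) :
    (unwrap I).1 ((inForests I f).1 (Forest.encFlat h r)) =
      (wordsIn I).1 ((tincl V f.len).1 ((I.inclR f.len).1 r)) := by
  rw [unwrap_inForests, Forest.unbracket_encFlat, split_ofRun I f h]

/-- Forgetting brackets does nothing to a sequence of inputs. -/
theorem word_of_flat (f : Forest) (h : f.flat = true) (w : f.obj I) :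
    (∃ z, (f.word I).1 w = (tincl V f.len).1 z) ∧
      (wordsIn I).1 ((f.word I).1 w) = (f.split I).1 w := by
  match f, h with
  | .one .input, _ => exact ⟨⟨w, rfl⟩, talgMap_letter (inputs I) w⟩
  | .cons .input f, h =>
    induction w using Forest.cons_induction with
    | cons a w =>
      obtain ⟨⟨z, hz⟩, e⟩ := word_of_flat f (by simpa [Forest.flat, Tree.isInput] using h) w
      have hw : ((Forest.cons .input f).word I).1 (Forest.consTm a w) =
        (letter V).1 a * (f.word I).1 w := rfl
      refine ⟨⟨powCons (M := V) a z, ?_⟩, ?_⟩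
      · rw [hw, hz]
        exact (tincl_powCons (M := V) a z).symm
      · rw [hw, split_consTm, ← e]
        exact talgMap_letter_mul (inputs I) _ _
    | add x y hx hy =>
      obtain ⟨⟨z, hz⟩, e⟩ := hx
      obtain ⟨⟨z', hz'⟩, e'⟩ := hy
      exact ⟨⟨z + z', by rw [map_add, hz, hz', map_add]⟩, by simp only [map_add, e, e']⟩

theorem inclR_toR {M : Bimodule.{u, v} S} (n : ℕ) (F : Hom M (talg V))
    (h : ∀ x, F x ∈ I.toAddSubgroup) (x : M) (hx : ∃ z, F.1 x = (tincl V n).1 z) :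
    (tincl V n).1 ((I.inclR n).1 ((I.toR n F h).1 x)) = F.1 x := by
  obtain ⟨z, hz⟩ := hx
  change (tincl V n).1 ((tproj V n).1 (F.1 x)) = _
  rw [hz, proj_incl]

/-- The map `unwrap` is compatible with multiplication from the right. If all entries are inputs,
both sides are products in the tensor algebra of `V`. -/
theorem unwrap_concatEnc (f g : Forest) (e : f.enc I) (w : g.obj I) :
    (unwrap I).1 ((inForests I (f.append g)).1 ((f.concatEnc I g).1 (tm e w))) =
      (unwrap I).1 ((inForests I f).1 e) * (g.split I).1 w := by
  by_cases h : (f.append g).flat = true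
  · have h' := h
    rw [Forest.flat_append, Bool.and_eq_true] at h'
    refine (congrArg (fun z => (unwrap I).1 ((inForests I (f.append g)).1 z))
      (toPick_of_true _ _ h (tm e w))).trans ?_
    refine (unwrap_encFlat I h _).trans ?_
    obtain ⟨⟨z, hz⟩, hw⟩ := word_of_flat I g h'.2 w
    induction e using Forest.enc_cases with
    | nonflat h1 => rw [h1] at h'; simp at h'
    | flat h1 r =>
      rw [inclR_toR]
      · rw [← hw, unwrap_encFlat I h1, ← Forest.encWord_encFlat h1]
        exact talgMap_mul (inputs I) _ _
      · change ∃ z, (f.encWord I).1 (Forest.encFlat h1 r) * (g.word I).1 w = _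
        rw [hz, Forest.encWord_encFlat, Forest.len_append]
        exact exists_tincl_mul _ _ _ _
  · rw [Bool.not_eq_true] at h
    refine (congrArg (fun z => (unwrap I).1 ((inForests I (f.append g)).1 z))
      (toPick_of_false _ _ h (tm e w))).trans ?_
    refine (unwrap_encNonflat I h _).trans ?_
    rw [unwrap_inForests, ← split_concat]
    rfl

/-- The map `unwrap` is compatible with multiplication by a letter from the left. -/
theorem unwrap_consEnc (t : Tree) (g : Forest) (x : t.obj I) (e : g.enc I) :
    (unwrap I).1 ((inForests I (.cons t g)).1 ((g.consEnc I t).1 (tm x e))) =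
      (letter (trees I)).1 ((inTrees I t).1 x) * (unwrap I).1 ((inForests I g).1 e) := by
  by_cases h : (Forest.cons t g).flat = true
  · refine (congrArg (fun z => (unwrap I).1 ((inForests I (.cons t g)).1 z))
      (toPick_of_true _ _ h (tm x e))).trans ?_
    refine (unwrap_encFlat I h _).trans ?_
    match t, h with
    | .input, h =>
      induction e using Forest.enc_cases with
      | nonflat h1 => simp [Forest.flat, h1] at h
      | flat h1 r =>
        refine (congrArg (wordsIn I).1 (inclR_toR I _ _ _ _ ?_)).trans ?_
        · change ∃ z, (letter V).1 x * (g.encWord I).1 (Forest.encFlat h1 r) = _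
          rw [Forest.encWord_encFlat]
          exact ⟨_, (tincl_powCons (M := V) x _).symm⟩
        · rw [unwrap_encFlat I h1, ← Forest.encWord_encFlat h1]
          exact talgMap_letter_mul (inputs I) _ _
  · rw [Bool.not_eq_true] at h
    refine (congrArg (fun z => (unwrap I).1 ((inForests I (.cons t g)).1 z))
      (toPick_of_false _ _ h (tm x e))).trans ?_
    refine (unwrap_encNonflat I h _).trans ?_
    rw [unwrap_inForests]
    exact split_consTm I x _

end Brackets

/-! ### The differential of a cobar construction -/

namespace CoalgData

variable (K : CoalgData.{u, v} S)

/-- The differential of the cobar construction, as an endomorphism of the tensor algebra. -/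
def diff : Hom (talg K.total) (talg K.total) := sumLift K.dPow

/-- The map given by `[1]^{⊗ k}` on `K^{⊗ k}`, for all `k`. -/
def shift : Hom (talg K.total) (talg K.total) :=
  sumLift (fun k => (tincl K.total k).comp (K.shiftPow k))

variable {K}

theorem sgn_incl (p : ℕ) (x : K.X) (y : K.piece x) :
    (K.sgn p).1 ((incl K.piece x).1 y) = (-1 : ℤ) ^ (p * (K.deg x + 1)) • (incl K.piece x).1 y :=
  sumLift_incl _ _ _

theorem sgnShift_incl (x : K.X) (y : K.piece x) :
    K.sgnShift.1 ((incl K.piece x).1 y) = (-1 : ℤ) ^ (K.deg x) • (incl K.piece x).1 y :=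
  sumLift_incl _ _ _

theorem diff_letter (a : K.total) : K.diff.1 ((letter K.total).1 a) = K.dGen.1 a :=
  sumLift_incl _ _ _

theorem diff_letter_mul (a : K.total) (w : talg K.total) :
    K.diff.1 ((letter K.total).1 a * w) =
      K.dGen.1 a * w + (letter K.total).1 (K.sgnShift.1 a) * K.diff.1 w := by
  induction w using sum_induction with
  | zero => simp
  | incl k w =>
    rw [← tincl_powCons]
    refine (sumLift_incl _ _ _).trans ?_
    refine (show (K.dPow (k + 1)).1 (powCons a w) = K.dGen.1 a * (tincl K.total k).1 w +
      (tcons K.total).1 (tm (K.sgnShift.1 a) ((K.dPow k).1 w)) from rfl).trans ?_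
    rw [tcons_tm]
    congr 2
    exact (sumLift_incl _ _ _).symm
  | add x y hx hy => simp only [mul_add, map_add, hx, hy]; abel

theorem shift_letter (a : K.total) : K.shift.1 ((letter K.total).1 a) = (letter K.total).1 a :=
  sumLift_incl _ _ _

theorem shift_letter_mul_tincl (k : ℕ) (a : K.total) (w : pow K.total k) :
    K.shift.1 ((letter K.total).1 a * (tincl K.total k).1 w) =
      (letter K.total).1 ((K.sgn (k + 1)).1 a) * K.shift.1 ((tincl K.total k).1 w) := by
  rw [← tincl_powCons]
  refine (sumLift_incl _ _ _).trans ?_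
  refine (tincl_powCons (M := K.total) ((K.sgn (k + 1)).1 a) ((K.shiftPow k).1 w)).trans ?_
  exact congrArg (fun z => (letter K.total).1 ((K.sgn (k + 1)).1 a) * z)
    (sumLift_incl (fun k => (tincl K.total k).comp (K.shiftPow k)) k w).symm

theorem dGen_apply (a : K.total) : K.dGen.1 a = -K.shift.1 (K.Δ.1 a) := rfl

end CoalgData

section Brackets

variable {V : Bimodule.{u, v} S} (I : HomogeneousIdeal V)

/-! ### Degrees of the sums over removals of brackets -/

/-- The elements of `⨁_β (V,I)^β` supported on trees, other than the input, with `n - 1` pairs of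
brackets. -/
def treesGr (n : ℕ) : AddSubgroup (trees I) :=
  AddSubgroup.closure {z | ∃ (t : Tree) (f : Forest) (x : (Tree.bracket t f).obj I),
    (Tree.bracket t f).brackets + 1 = n ∧ z = (inTrees I (.bracket t f)).1 x}

/-- The elements of the direct sum of the bimodules of enclosed sequences which are supported on
sequences with `n - 1` pairs of brackets and more than `l` entries. -/
def forestsGr (n l : ℕ) : AddSubgroup (forests I) :=
  AddSubgroup.closure {z | ∃ (f : Forest) (e : f.enc I),
    f.brackets + 1 = n ∧ l ≤ f.len ∧ z = (inForests I f).1 e}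

theorem forestsGr_zero (l : ℕ) : forestsGr I 0 l = ⊥ := by
  simp [forestsGr]

theorem inForests_mem_forestsGr {f : Forest} {n l : ℕ} (hn : f.brackets + 1 = n) (hl : l ≤ f.len)
    (e : f.enc I) : (inForests I f).1 e ∈ forestsGr I n l :=
  AddSubgroup.subset_closure ⟨f, e, hn, hl, rfl⟩

theorem close_mem_treesGr {n : ℕ} {e : forests I} (he : e ∈ forestsGr I n 1) :
    (close I).1 e ∈ treesGr I (n + 1) := by
  induction he using AddSubgroup.closure_induction with
  | mem y hy =>
    obtain ⟨f, e, hn, hl, rfl⟩ := hy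
    match f with
    | .one t => simp [Forest.len] at hl
    | .cons t f =>
      rw [close_inForests_cons]
      exact AddSubgroup.subset_closure ⟨t, f, _, by rw [← hn]; rfl, rfl⟩
  | zero => rw [map_zero]; exact zero_mem _
  | add x y _ _ hx hy => rw [map_add]; exact add_mem hx hy
  | neg x _ hx => rw [map_neg]; exact neg_mem hx

theorem stepOne_mem (t : Tree) (δt : Hom (t.obj I) (trees I))
    (h : ∀ x, δt.1 x ∈ treesGr I t.brackets) (x : t.obj I) :
    (stepOne I t δt).1 x ∈ forestsGr I t.brackets 0 := by
  rw [stepOne, Hom.sub_apply]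
  refine sub_mem ?_ ?_
  · match t with
    | .input => exact zero_mem _
    | .bracket t f =>
      exact inForests_mem_forestsGr I (f := .cons t f) (n := (Tree.bracket t f).brackets) rfl
        (Nat.zero_le _) x
  · rw [Hom.comp_apply]
    have h := h x
    generalize δt.1 x = y at h ⊢
    induction h using AddSubgroup.closure_induction with
    | mem y hy =>
      obtain ⟨t, f, x, hn, rfl⟩ := hy
      rw [sumLift_incl]
      exact inForests_mem_forestsGr I (f := .one (.bracket t f)) hn (Nat.zero_le _) _
    | zero => rw [map_zero]; exact zero_mem _
    | add x y _ _ hx hy => rw [map_add]; exact add_mem hx hy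
    | neg x _ hx => rw [map_neg]; exact neg_mem hx

theorem stepCons_mem (t : Tree) (f : Forest) (δt : Hom (t.obj I) (trees I))
    (δf : Hom (f.obj I) (forests I)) (ht : ∀ x, δt.1 x ∈ treesGr I t.brackets)
    (hf : ∀ w, δf.1 w ∈ forestsGr I f.brackets f.len) (w : (Forest.cons t f).obj I) :
    (stepCons I t f δt δf).1 w ∈ forestsGr I (Forest.cons t f).brackets (Forest.cons t f).len := by
  induction w using Forest.cons_induction with
  | add x y hx hy =>
    exact (congrArg (· ∈ _) (map_add (stepCons I t f δt δf).1 x y)).mpr (add_mem hx hy)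
  | cons x w =>
    refine add_mem (sub_mem ?_ ?_) (zsmul_mem ?_ _)
    · match t with
      | .input => exact zero_mem _
      | .bracket a c =>
        refine inForests_mem_forestsGr I ?_ ?_ _
        · simp only [Forest.brackets_append, Forest.brackets, Tree.brackets]; omega
        · simp only [Forest.len_append, Forest.len]; omega
    · change (sumTensorLift _).1 (tm (δt.1 x) w) ∈ _
      have h := ht x
      generalize δt.1 x = y at h ⊢
      induction h using AddSubgroup.closure_induction with
      | mem y hy =>
        obtain ⟨a, c, x, hn, rfl⟩ := hy
        rw [sumTensorLift_tm_incl]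
        exact inForests_mem_forestsGr I (f := .cons (.bracket a c) f)
          (by rw [Forest.brackets, Forest.brackets, ← hn]; omega) le_rfl _
      | zero => rw [zero_tm, map_zero]; exact zero_mem _
      | add x y _ _ hx hy => rw [add_tm, map_add]; exact add_mem hx hy
      | neg x _ hx => rw [neg_tm, map_neg]; exact neg_mem hx
    · change (tensorSumLift _).1 (tm x (δf.1 w)) ∈ _
      have h := hf w
      generalize δf.1 w = y at h ⊢
      induction h using AddSubgroup.closure_induction with
      | mem y hy =>
        obtain ⟨g, e, hn, hl, rfl⟩ := hy
        rw [tensorSumLift_tm_incl]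
        exact inForests_mem_forestsGr I (f := .cons t g)
          (by rw [Forest.brackets, Forest.brackets, ← hn]; omega)
          (Nat.succ_le_succ hl) _
      | zero => rw [tm_zero, map_zero]; exact zero_mem _
      | add x y _ _ hx hy => rw [tm_add, map_add]; exact add_mem hx hy
      | neg x _ hx => rw [tm_neg, map_neg]; exact neg_mem hx

mutual
theorem Tree.delta_mem (t : Tree) (x : t.obj I) : (t.delta I).1 x ∈ treesGr I t.brackets := by
  match t with
  | .input => exact zero_mem _
  | .bracket t f =>
    refine close_mem_treesGr I (n := (Forest.cons t f).brackets) ?_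
    change (fromPick (t.isInput && f.flat) _ _).1 x ∈ _
    induction x using pick_cases with
    | isTrue h x => rw [fromPick_pickTrue]; exact zero_mem _
    | isFalse h x =>
      rw [fromPick_pickFalse]
      have := stepCons_mem I t f (t.delta I) (f.delta I) (Tree.delta_mem t) (Forest.delta_mem f) x
      refine AddSubgroup.closure_mono ?_ this
      rintro z ⟨f, e, hn, hl, rfl⟩
      exact ⟨f, e, hn, (Nat.le_add_left _ _).trans hl, rfl⟩
theorem Forest.delta_mem (f : Forest) (w : f.obj I) :
    (f.delta I).1 w ∈ forestsGr I f.brackets f.len := by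
  match f with
  | .one t => exact stepOne_mem I t (t.delta I) (Tree.delta_mem t) w
  | .cons t f =>
    exact stepCons_mem I t f (t.delta I) (f.delta I) (Tree.delta_mem t) (Forest.delta_mem f) w
end

/-- Sequences of inputs have degree `0`, and there is nothing below this degree. -/
theorem Forest.delta_of_flat {f : Forest} (h : f.flat = true) (w : f.obj I) :
    (f.delta I).1 w = 0 := by
  have := Forest.delta_mem I f w
  rwa [(Forest.flat_iff f).1 h, forestsGr_zero, AddSubgroup.mem_bot] at this

/-- The signed sum over the removals of all internal brackets of an enclosed sequence, as an
endomorphism of the direct sum of the bimodules of enclosed sequences. -/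
def innerDelta : Hom (forests I) (forests I) :=
  sumLift (fun f => (f.delta I).comp (f.unbracket I))

theorem innerDelta_inForests (f : Forest) (e : f.enc I) :
    (innerDelta I).1 ((inForests I f).1 e) = (f.delta I).1 ((f.unbracket I).1 e) :=
  sumLift_incl _ _ _

theorem innerDelta_mem {n l : ℕ} {e : forests I} (he : e ∈ forestsGr I (n + 1) l) :
    (innerDelta I).1 e ∈ forestsGr I n l := by
  induction he using AddSubgroup.closure_induction with
  | mem y hy =>
    obtain ⟨f, e, hn, hl, rfl⟩ := hy
    rw [innerDelta_inForests, ← Nat.succ_injective hn]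
    refine AddSubgroup.closure_mono ?_ (Forest.delta_mem I f _)
    rintro z ⟨f, e, hn, hl', rfl⟩
    exact ⟨f, e, hn, hl.trans hl', rfl⟩
  | zero => rw [map_zero]; exact zero_mem _
  | add x y _ _ hx hy => rw [map_add]; exact add_mem hx hy
  | neg x _ hx => rw [map_neg]; exact neg_mem hx

/-- The case distinction in the definition of `Tree.delta` is not needed, because no bracket can be
removed from a sequence of inputs. -/
theorem delta_enclose {t : Tree} {f : Forest} (e : (Forest.cons t f).enc I) :
    (Tree.delta I (.bracket t f)).1 (Tree.enclose e) =
      (close I).1 ((innerDelta I).1 ((inForests I (.cons t f)).1 e)) := by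
  rw [innerDelta_inForests]
  refine congrArg (close I).1 ?_
  induction e using Forest.enc_cases with
  | flat h r =>
    rw [Forest.delta_of_flat I h]
    exact fromPick_pickTrue _ _ h r
  | nonflat h w =>
    rw [Forest.unbracket_encNonflat]
    exact fromPick_pickFalse _ _ h w

/-! ### The differential of the cobar construction of `B^∞(V,I)` -/

/-- The differential of the cobar construction of `B^∞(V,I)`. -/
def cobarD : Hom (talg (trees I)) (talg (trees I)) := (Binfinity I).diff

/-- The map given by `[1]^{⊗ k}` on the tensor powers of `B^∞(V,I)`. -/
def cobarShift : Hom (talg (trees I)) (talg (trees I)) := (Binfinity I).shift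

theorem cobarShift_letter (a : trees I) :
    (cobarShift I).1 ((letter (trees I)).1 a) = (letter (trees I)).1 a :=
  CoalgData.shift_letter (K := Binfinity I) a

theorem cobarShift_letter_mul_tincl (k : ℕ) (t : Tree) (x : t.obj I) (w : pow (trees I) k) :
    (cobarShift I).1 ((letter (trees I)).1 ((inTrees I t).1 x) * (tincl (trees I) k).1 w) =
      (-1 : ℤ) ^ ((k + 1) * (t.brackets + 1)) • ((letter (trees I)).1 ((inTrees I t).1 x) *
        (cobarShift I).1 ((tincl (trees I) k).1 w)) := by
  rw [← smul_mul_assoc, ← map_zsmul]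
  refine (CoalgData.shift_letter_mul_tincl (K := Binfinity I) _ _ _).trans ?_
  refine congrArg (fun z => (letter (trees I)).1 z * (cobarShift I).1 ((tincl (trees I) k).1 w)) ?_
  exact CoalgData.sgn_incl (K := Binfinity I) _ t x

theorem split_len (f : Forest) (w : f.obj I) :
    ∃ z, (f.split I).1 w = (tincl (trees I) f.len).1 z := by
  match f with
  | .one t => exact ⟨_, rfl⟩
  | .cons t f =>
    induction w using Forest.cons_induction with
    | cons x w =>
      obtain ⟨z, hz⟩ := split_len f w
      rw [split_consTm, hz]
      exact ⟨powCons ((inTrees I t).1 x) z, (tincl_powCons _ _).symm⟩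
    | add x y hx hy =>
      obtain ⟨z, hz⟩ := hx
      obtain ⟨z', hz'⟩ := hy
      exact ⟨z + z', by rw [map_add, hz, hz', map_add]⟩

theorem cobarShift_split (f : Forest) (w : f.obj I) :
    (cobarShift I).1 ((f.split I).1 w) = (-1 : ℤ) ^ f.signExp • (f.split I).1 w := by
  match f with
  | .one t =>
    rw [Forest.signExp, pow_zero, one_smul]
    exact cobarShift_letter I _
  | .cons t f =>
    induction w using Forest.cons_induction with
    | cons x w =>
      obtain ⟨z, hz⟩ := split_len I f w
      rw [split_consTm, hz, cobarShift_letter_mul_tincl, ← hz, cobarShift_split f w, Forest.signExp,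
        pow_add, mul_smul, mul_smul_comm]
    | add x y hx hy => rw [map_add, map_add, hx, hy, smul_add]

/-- The sum of all coproducts of `B^∞(V,I)`. -/
def coproduct : Hom (trees I) (talg (trees I)) := sumLift (fun t => t.coproducts I)

theorem coproduct_input (x : Tree.input.obj I) :
    (coproduct I).1 ((inTrees I .input).1 x) = 0 :=
  sumLift_incl _ _ _

theorem coproduct_enclose {t : Tree} {f : Forest} (e : (Forest.cons t f).enc I) :
    (coproduct I).1 ((inTrees I (.bracket t f)).1 (Tree.enclose e)) =
      (letter (trees I)).1 ((close I).1 ((innerDelta I).1 ((inForests I (.cons t f)).1 e))) -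
      (-1 : ℤ) ^ (Forest.cons t f).signExp •
        (unwrap I).1 ((inForests I (.cons t f)).1 e) := by
  rw [unwrap_inForests, ← delta_enclose]
  exact sumLift_incl _ _ _

theorem cobarD_letter (a : trees I) :
    (cobarD I).1 ((letter (trees I)).1 a) = -(cobarShift I).1 ((coproduct I).1 a) :=
  CoalgData.diff_letter (K := Binfinity I) a

theorem cobarD_input (x : Tree.input.obj I) :
    (cobarD I).1 ((letter (trees I)).1 ((inTrees I .input).1 x)) = 0 := by
  rw [cobarD_letter, coproduct_input, map_zero, neg_zero]

/-- On a tree, the differential removes the outer bracket with sign `1`, and the internal brackets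
with the opposite of the sign in `Tree.delta`. -/
theorem cobarD_enclose {t : Tree} {f : Forest} (e : (Forest.cons t f).enc I) :
    (cobarD I).1 ((letter (trees I)).1 ((inTrees I (.bracket t f)).1 (Tree.enclose e))) =
      (unwrap I).1 ((inForests I (.cons t f)).1 e) -
        (letter (trees I)).1 ((close I).1 ((innerDelta I).1 ((inForests I (.cons t f)).1 e))) := by
  rw [cobarD_letter, coproduct_enclose, map_sub, cobarShift_letter, unwrap_inForests, map_zsmul,
    cobarShift_split, smul_smul, ← mul_pow, neg_one_mul, neg_neg, one_pow, one_smul, neg_sub]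

theorem cobarD_letter_mul (t : Tree) (x : t.obj I) (w : talg (trees I)) :
    (cobarD I).1 ((letter (trees I)).1 ((inTrees I t).1 x) * w) =
      (cobarD I).1 ((letter (trees I)).1 ((inTrees I t).1 x)) * w +
      (-1 : ℤ) ^ t.brackets • ((letter (trees I)).1 ((inTrees I t).1 x) * (cobarD I).1 w) := by
  refine (CoalgData.diff_letter_mul (K := Binfinity I) _ _).trans ?_
  refine congrArg₂ (· + ·) ?_ ?_
  · exact congrArg (· * w) (CoalgData.diff_letter (K := Binfinity I) _).symm
  · change _ = _ • (_ * (cobarD I).1 w)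
    refine Eq.trans ?_ (smul_mul_assoc _ _ _)
    refine Eq.trans ?_ (congrArg (· * _) (map_zsmul (letter (trees I)).1 _ _))
    refine congrArg (fun z => (letter (trees I)).1 z * (cobarD I).1 w) ?_
    exact CoalgData.sgnShift_incl (K := Binfinity I) t x

/-- The projection of `⨁_β (V,I)^β` to the summand of the input. -/
def inputProj : Hom (trees I) V := proj (fun t : Tree => t.obj I) .input

theorem inputProj_inputs (x : V) : (inputProj I).1 ((inputs I).1 x) = x :=
  proj_incl (M := fun t : Tree => t.obj I) .input x

theorem inputProj_bracket (t : Tree) (f : Forest) (x : (Tree.bracket t f).obj I) :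
    (inputProj I).1 ((inTrees I (.bracket t f)).1 x) = 0 :=
  proj_incl_ne (by simp) x

/-- The homomorphism from the cobar algebra to the tensor algebra of `V` which is the identity on
the letters `V` and vanishes on all other letters. -/
def wordsOut : Hom (talg (trees I)) (talg V) := talgMap (inputProj I)

theorem wordsOut_wordsIn (x : talg V) : (wordsOut I).1 ((wordsIn I).1 x) = x := by
  induction x using talg_induction with
  | letter a =>
    refine (congrArg _ (talgMap_letter _ _)).trans ((talgMap_letter _ _).trans ?_)
    exact congrArg (letter V).1 (inputProj_inputs I a)
  | cons a w ih =>
    refine (congrArg _ (talgMap_letter_mul _ _ _)).trans ((talgMap_letter_mul _ _ _).trans ?_)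
    refine congrArg₂ (fun a b => (letter V).1 a * b) ?_ ih
    exact inputProj_inputs I a
  | add x y hx hy => rw [map_add, map_add, hx, hy]

/-- The sum over the removals of all brackets of a single tree computes the differential. The outer
bracket comes first, so that the signs of the internal ones change compared to `Tree.delta`. -/
theorem unwrap_stepOne (t : Tree) (x : t.obj I) :
    (unwrap I).1 ((stepOne I t (t.delta I)).1 x) =
      (cobarD I).1 ((letter (trees I)).1 ((inTrees I t).1 x)) := by
  rw [stepOne, Hom.sub_apply, map_sub, Hom.comp_apply]
  have key : ∀ y ∈ treesGr I t.brackets,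
      (unwrap I).1 ((sumLift (fun t₁ => (inForests I (.one t₁)).comp ((Forest.one t₁).toEnc I)) :
        Hom (trees I) (forests I)).1 y) = (letter (trees I)).1 y := by
    intro y hy
    induction hy using AddSubgroup.closure_induction with
    | mem y hy =>
      obtain ⟨a, c, y, -, rfl⟩ := hy
      rw [sumLift_incl]
      refine (congrArg (fun z => (unwrap I).1 ((inForests I (.one (.bracket a c))).1 z))
        (Forest.toEnc_of_nonflat (f := .one (.bracket a c)) rfl y)).trans ?_
      exact unwrap_encNonflat I _ _
    | zero => simp only [map_zero]
    | add x y _ _ hx hy => simp only [map_add, hx, hy]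
    | neg x _ hx => simp only [map_neg, hx]
  rw [key _ (Tree.delta_mem I t x)]
  match t with
  | .input =>
    rw [cobarD_input]
    refine (congrArg₂ (· - ·) (map_zero (unwrap I).1) (map_zero (letter (trees I)).1)).trans ?_
    exact sub_zero 0
  | .bracket t f =>
    induction x using Tree.enclose_cases with
    | h e => rw [cobarD_enclose, dropOne_enclose, delta_enclose]

/-- The recursion for the sum over the removals of all brackets is the graded Leibniz rule. -/
theorem unwrap_stepCons (t : Tree) (f : Forest) (δf : Hom (f.obj I) (forests I))
    (x : t.obj I) (w : f.obj I) :
    (unwrap I).1 ((stepCons I t f (t.delta I) δf).1 (tm x w)) =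
      (cobarD I).1 ((letter (trees I)).1 ((inTrees I t).1 x)) * (f.split I).1 w +
      (-1 : ℤ) ^ t.brackets • ((letter (trees I)).1 ((inTrees I t).1 x) *
        (unwrap I).1 (δf.1 w)) := by
  rw [stepCons, Hom.add_apply, map_add, Hom.sub_apply, map_sub, Hom.zsmul_apply, map_zsmul,
    Hom.comp_apply, Hom.comp_apply, map_tm, map_tm, Hom.id_apply, Hom.id_apply]
  have key : ∀ y ∈ treesGr I t.brackets, (unwrap I).1 ((sumTensorLift (fun t₁ =>
        (inForests I (.cons t₁ f)).comp ((Forest.cons t₁ f).toEnc I)) :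
          Hom (tensor (trees I) (f.obj I)) (forests I)).1 (tm y w)) =
      (letter (trees I)).1 y * (f.split I).1 w := by
    intro y hy
    induction hy using AddSubgroup.closure_induction with
    | mem y hy =>
      obtain ⟨a, c, y, -, rfl⟩ := hy
      rw [sumTensorLift_tm_incl]
      refine (congrArg (fun z => (unwrap I).1 ((inForests I (.cons (.bracket a c) f)).1 z))
        (Forest.toEnc_of_nonflat (f := .cons (.bracket a c) f) rfl (tm y w))).trans ?_
      exact (unwrap_encNonflat I _ _).trans (split_consTm I _ _)
    | zero => simp only [zero_tm, map_zero, zero_mul]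
    | add x y _ _ hx hy => simp only [add_tm, map_add, hx, hy, add_mul]
    | neg x _ hx => simp only [neg_tm, map_neg, hx, neg_mul]
  have key' : ∀ e : forests I, (unwrap I).1 ((tensorSumLift (fun g =>
        (inForests I (.cons t g)).comp (Forest.consEnc I t g)) :
          Hom (tensor (t.obj I) (forests I)) (forests I)).1 (tm x e)) =
      (letter (trees I)).1 ((inTrees I t).1 x) * (unwrap I).1 e := by
    intro e
    induction e using sum_induction with
    | zero => simp only [tm_zero, map_zero, mul_zero]
    | incl g e =>
      rw [tensorSumLift_tm_incl]
      exact unwrap_consEnc I t g x e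
    | add x y hx hy => simp only [tm_add, map_add, hx, hy, mul_add]
  rw [key _ (Tree.delta_mem I t x), key']
  congr 1
  match t with
  | .input =>
    rw [cobarD_input, zero_mul]
    refine (congrArg₂ (fun a b => a - (letter (trees I)).1 b * (f.split I).1 w)
      (map_zero (unwrap I).1) rfl).trans ?_
    exact (congrArg (fun b => 0 - b * (f.split I).1 w) (map_zero (letter (trees I)).1)).trans
      (by rw [zero_mul, sub_zero])
  | .bracket t g =>
    induction x using Tree.enclose_cases with
    | h e =>
      rw [cobarD_enclose, delta_enclose, sub_mul]
      congr 1
      exact unwrap_concatEnc I (.cons t g) f e w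

/-- The differential on the summand of a sequence is the signed sum over the removals of all
brackets. -/
theorem cobarD_split (f : Forest) (w : f.obj I) :
    (cobarD I).1 ((f.split I).1 w) = (unwrap I).1 ((f.delta I).1 w) := by
  match f with
  | .one t => exact (unwrap_stepOne I t w).symm
  | .cons t f =>
    induction w using Forest.cons_induction with
    | cons x w =>
      rw [split_consTm, cobarD_letter_mul, cobarD_split f w]
      exact (unwrap_stepCons I t f (f.delta I) x w).symm
    | add x y hx hy => rw [map_add, map_add, hx, hy, map_add, map_add]

theorem cobarD_unwrap (e : forests I) :
    (cobarD I).1 ((unwrap I).1 e) = (unwrap I).1 ((innerDelta I).1 e) := by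
  induction e using sum_induction with
  | zero => simp only [map_zero]
  | incl f e => rw [unwrap_inForests, cobarD_split, innerDelta_inForests]
  | add x y hx hy => simp only [map_add, hx, hy]

/-- The bimodules of enclosed sequences embed into the cobar algebra, although tensor products of
inclusions need not be injective: the only component that is not an identity map is the inclusion of
the ideal in the tensor algebra of `V`. -/
theorem unwrap_injective (e : forests I) (h : (unwrap I).1 e = 0) : e = 0 := by
  have h1 : ∀ f, (inSequences I f).1 ((f.unbracket I).1 ((proj _ f).1 e)) =
      (inSequences I f).1 ((proj _ f).1 ((toSequences I).1 ((unwrap I).1 e))) := by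
    intro f
    congr 1
    clear h
    induction e using sum_induction with
    | zero => simp only [map_zero]
    | incl g e =>
      rw [unwrap_inForests, toSequences_split]
      by_cases hg : g = f
      · subst hg; rw [proj_incl, proj_incl]
      · rw [proj_incl_ne hg, proj_incl_ne hg, map_zero]
    | add x y hx hy => simp only [map_add, hx, hy]
  refine sum_ext fun f => ?_
  have h2 := h1 f
  rw [h, map_zero, map_zero, map_zero] at h2
  have h3 : (unwrap I).1 ((inForests I f).1 ((proj _ f).1 e)) = 0 := by
    rw [unwrap_inForests, ← proj_incl (M := fun f : Forest => f.obj I) f ((f.unbracket I).1 _)]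
    rw [h2, map_zero, map_zero]
  refine Eq.trans ?_ (map_zero (proj _ f).1).symm
  generalize (proj (fun f : Forest => f.enc I) f).1 e = y at h3 ⊢
  induction y using Forest.enc_cases with
  | nonflat hf w =>
    rw [unwrap_encNonflat] at h3
    rw [split_injective I f w h3]
    exact map_zero (toPick f.flat (fun h' => absurd (hf.symm.trans h') (by simp))
      (fun _ => Hom.id _)).1
  | flat hf r =>
    rw [unwrap_encFlat] at h3
    have h4 : (wordsOut I).1 ((wordsIn I).1 ((tincl V f.len).1 ((I.inclR f.len).1 r))) = 0 := by
      rw [h3, map_zero]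
    rw [wordsOut_wordsIn] at h4
    have h5 : (I.inclR f.len).1 r = 0 := by
      rw [← proj_incl (M := pow V) f.len ((I.inclR f.len).1 r), h4, map_zero]
    have h6 : r = 0 := Subtype.ext h5
    rw [h6]
    exact map_zero (toPick f.flat (fun _ => Hom.id _)
      (fun h' => absurd (hf.symm.trans h') (by simp))).1

/-! ### The differential squares to zero -/

theorem cobarD_split_mul (f : Forest) (w : f.obj I) (y : talg (trees I)) :
    (cobarD I).1 ((f.split I).1 w * y) = (cobarD I).1 ((f.split I).1 w) * y +
      (-1 : ℤ) ^ f.brackets • ((f.split I).1 w * (cobarD I).1 y) := by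
  match f with
  | .one t => exact cobarD_letter_mul I t w y
  | .cons t f =>
    induction w using Forest.cons_induction with
    | cons x w =>
      rw [split_consTm, mul_assoc, cobarD_letter_mul, cobarD_letter_mul, cobarD_split_mul f w,
        Forest.brackets, pow_add, mul_smul]
      simp only [mul_add, add_mul, smul_add, mul_assoc, mul_smul_comm, smul_mul_assoc, add_assoc]
    | add x y' hx hy =>
      simp only [map_add, add_mul, smul_add, hx, hy]
      abel

theorem cobarD_unwrap_mul {n l : ℕ} {e : forests I} (he : e ∈ forestsGr I n l)
    (y : talg (trees I)) :
    (cobarD I).1 ((unwrap I).1 e * y) = (cobarD I).1 ((unwrap I).1 e) * y -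
      (-1 : ℤ) ^ n • ((unwrap I).1 e * (cobarD I).1 y) := by
  induction he using AddSubgroup.closure_induction with
  | mem e he =>
    obtain ⟨f, e, rfl, -, rfl⟩ := he
    rw [unwrap_inForests, cobarD_split_mul, pow_succ, mul_neg_one, neg_smul, sub_neg_eq_add]
  | zero => simp only [map_zero, zero_mul, smul_zero, sub_zero]
  | add a b _ _ ha hb => simp only [map_add, add_mul, smul_add, ha, hb]; abel
  | neg a _ ha => simp only [map_neg, neg_mul, smul_neg, ha]; abel

theorem cobarD_close {n : ℕ} {e : forests I} (he : e ∈ forestsGr I n 1) :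
    (cobarD I).1 ((letter (trees I)).1 ((close I).1 e)) =
      (unwrap I).1 e - (letter (trees I)).1 ((close I).1 ((innerDelta I).1 e)) := by
  induction he using AddSubgroup.closure_induction with
  | mem e he =>
    obtain ⟨f, e, -, hl, rfl⟩ := he
    match f with
    | .one t => simp [Forest.len] at hl
    | .cons t f => rw [close_inForests_cons, cobarD_enclose]
  | zero => simp only [map_zero, sub_zero]
  | add a b _ _ ha hb => simp only [map_add, ha, hb]; abel
  | neg a _ ha => simp only [map_neg, ha]; abel

theorem cobarD_letter_eq (t : Tree) (x : t.obj I) :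
    ∃ e ∈ forestsGr I t.brackets 0,
      (cobarD I).1 ((letter (trees I)).1 ((inTrees I t).1 x)) = (unwrap I).1 e :=
  ⟨_, Forest.delta_mem I (.one t) (Forest.single x), cobarD_split I (.one t) (Forest.single x)⟩

mutual
theorem cobarD_cobarD_letter (t : Tree) (x : t.obj I) :
    (cobarD I).1 ((cobarD I).1 ((letter (trees I)).1 ((inTrees I t).1 x))) = 0 := by
  match t with
  | .input => rw [cobarD_input, map_zero]
  | .bracket t f =>
    induction x using Tree.enclose_cases with
    | h e =>
      -- All terms that remove the outer bracket cancel. As `unwrap` is injective, the other ones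
      -- vanish because the differential squares to zero on the sequence inside the outer bracket.
      have h : (innerDelta I).1 ((innerDelta I).1 ((inForests I (.cons t f)).1 e)) = 0 := by
        refine unwrap_injective I _ ?_
        rw [← cobarD_unwrap, ← cobarD_unwrap, unwrap_inForests]
        exact cobarD_cobarD_split (.cons t f) _
      have hm : (innerDelta I).1 ((inForests I (.cons t f)).1 e) ∈
          forestsGr I (Forest.cons t f).brackets 1 :=
        innerDelta_mem I (inForests_mem_forestsGr I rfl (Nat.le_add_left _ _) e)
      rw [cobarD_enclose, map_sub, cobarD_close I hm, h, cobarD_unwrap]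
      simp only [map_zero, sub_zero, sub_self]
theorem cobarD_cobarD_split (f : Forest) (w : f.obj I) :
    (cobarD I).1 ((cobarD I).1 ((f.split I).1 w)) = 0 := by
  match f with
  | .one t => exact cobarD_cobarD_letter t w
  | .cons t f =>
    induction w using Forest.cons_induction with
    | cons x w =>
      obtain ⟨e, he, hx⟩ := cobarD_letter_eq I t x
      have hxx := cobarD_cobarD_letter t x
      rw [hx] at hxx
      rw [split_consTm, cobarD_letter_mul, map_add, map_zsmul, cobarD_letter_mul, hx,
        cobarD_unwrap_mul I he, hxx, cobarD_cobarD_split f w]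
      simp
    | add x y hx hy => simp only [map_add, hx, hy, add_zero]
end

theorem cobarD_cobarD (z : talg (trees I)) : (cobarD I).1 ((cobarD I).1 z) = 0 := by
  induction z using split_induction with
  | split f w => exact cobarD_cobarD_split I f w
  | add x y hx hy => rw [map_add, map_add, hx, hy, add_zero]

/-! ### The grading of the cobar algebra -/

/-- The part of degree `n` of the cobar algebra, generated by the bimodules of sequences with `n`
pairs of brackets. -/
def sequencesGr (n : ℕ) : AddSubgroup (talg (trees I)) :=
  AddSubgroup.closure {z | ∃ (f : Forest) (w : f.obj I), f.brackets = n ∧ z = (f.split I).1 w}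

theorem split_mem {f : Forest} {n : ℕ} (h : f.brackets = n) (w : f.obj I) :
    (f.split I).1 w ∈ sequencesGr I n :=
  AddSubgroup.subset_closure ⟨f, w, h, rfl⟩

theorem sequencesGr_induction {n : ℕ} {p : ∀ z, z ∈ sequencesGr I n → Prop}
    (split : ∀ (f : Forest) (h : f.brackets = n) (w : f.obj I), p _ (split_mem I h w))
    (add : ∀ x y hx hy, p x hx → p y hy → p (x + y) (add_mem hx hy)) (zero : p 0 (zero_mem _))
    {z : talg (trees I)} (hz : z ∈ sequencesGr I n) : p z hz := by
  induction hz using AddSubgroup.closure_induction'' with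
  | mem y hy => obtain ⟨f, w, h, rfl⟩ := hy; exact split f h w
  | neg_mem y hy =>
    obtain ⟨f, w, h, rfl⟩ := hy
    simp only [← map_neg]
    exact split f h _
  | zero => exact zero
  | add x y hx' hy' hx hy => exact add x y hx' hy' hx hy

theorem unwrap_mem {n l : ℕ} {e : forests I} (he : e ∈ forestsGr I (n + 1) l) :
    (unwrap I).1 e ∈ sequencesGr I n := by
  induction he using AddSubgroup.closure_induction with
  | mem e he =>
    obtain ⟨f, e, h, -, rfl⟩ := he
    rw [unwrap_inForests]
    exact split_mem I (Nat.succ_injective h) _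
  | zero => rw [map_zero]; exact zero_mem _
  | add a b _ _ ha hb => rw [map_add]; exact add_mem ha hb
  | neg a _ ha => rw [map_neg]; exact neg_mem ha

theorem letter_mem {n : ℕ} {y : trees I} (hy : y ∈ treesGr I (n + 1)) :
    (letter (trees I)).1 y ∈ sequencesGr I n := by
  induction hy using AddSubgroup.closure_induction with
  | mem y hy =>
    obtain ⟨t, f, x, h, rfl⟩ := hy
    exact split_mem I (f := .one (.bracket t f)) (Nat.succ_injective h) (Forest.single x)
  | zero => rw [map_zero]; exact zero_mem _
  | add a b _ _ ha hb => rw [map_add]; exact add_mem ha hb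
  | neg a _ ha => rw [map_neg]; exact neg_mem ha

theorem letter_close_mem {n : ℕ} {e : forests I} (he : e ∈ forestsGr I n 1) :
    (letter (trees I)).1 ((close I).1 e) ∈ sequencesGr I n :=
  letter_mem I (close_mem_treesGr I he)

theorem cobarD_mem {n : ℕ} {z : talg (trees I)} (hz : z ∈ sequencesGr I (n + 1)) :
    (cobarD I).1 z ∈ sequencesGr I n := by
  induction hz using sequencesGr_induction with
  | split f h w => rw [cobarD_split]; exact unwrap_mem I (h ▸ Forest.delta_mem I f w)
  | add x y _ _ hx hy => rw [map_add]; exact add_mem hx hy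
  | zero => rw [map_zero]; exact zero_mem _

theorem cobarD_of_mem_zero {z : talg (trees I)} (hz : z ∈ sequencesGr I 0) :
    (cobarD I).1 z = 0 := by
  induction hz using sequencesGr_induction with
  | split f h w =>
    rw [cobarD_split, Forest.delta_of_flat I ((Forest.flat_iff f).2 h), map_zero]
  | add x y _ _ hx hy => rw [map_add, hx, hy, add_zero]
  | zero => rw [map_zero]

theorem cobarD_mul {n : ℕ} {z : talg (trees I)} (hz : z ∈ sequencesGr I n)
    (y : talg (trees I)) : (cobarD I).1 (z * y) =
      (cobarD I).1 z * y + (-1 : ℤ) ^ n • (z * (cobarD I).1 y) := by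
  induction hz using sequencesGr_induction with
  | split f h w => rw [cobarD_split_mul, h]
  | add a b _ _ ha hb => simp only [map_add, add_mul, smul_add, ha, hb]; abel
  | zero => simp only [map_zero, zero_mul, smul_zero, add_zero]

theorem mul_mem_sequencesGr {m n : ℕ} {y z : talg (trees I)} (hy : y ∈ sequencesGr I m)
    (hz : z ∈ sequencesGr I n) : y * z ∈ sequencesGr I (m + n) := by
  induction hy using sequencesGr_induction with
  | split f h w =>
    induction hz using sequencesGr_induction with
    | split g h' w' =>
      rw [← split_concat]
      exact split_mem I (by rw [Forest.brackets_append, h, h']) _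
    | add a b _ _ ha hb => rw [mul_add]; exact add_mem ha hb
    | zero => rw [mul_zero]; exact zero_mem _
  | add a b _ _ ha hb => rw [add_mul]; exact add_mem ha hb
  | zero => rw [zero_mul]; exact zero_mem _

/-- The projection of the cobar algebra to the part of degree `n`. -/
def sequencesProj (n : ℕ) : Hom (talg (trees I)) (talg (trees I)) :=
  (sumLift (fun f : Forest => if f.brackets = n then f.split I else 0)).comp (toSequences I)

theorem sequencesProj_split (n : ℕ) (f : Forest) (w : f.obj I) :
    (sequencesProj I n).1 ((f.split I).1 w) = if f.brackets = n then (f.split I).1 w else 0 := by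
  rw [sequencesProj, Hom.comp_apply, toSequences_split, sumLift_incl]
  split_ifs <;> rfl

theorem sequencesProj_of_mem {m n : ℕ} {z : talg (trees I)} (hz : z ∈ sequencesGr I m) :
    (sequencesProj I n).1 z = if m = n then z else 0 := by
  induction hz using sequencesGr_induction with
  | split f h w => rw [sequencesProj_split, h]
  | add a b _ _ ha hb => rw [map_add, ha, hb]; split_ifs <;> simp
  | zero => simp

theorem isInternal_sequencesGr : DirectSum.IsInternal (sequencesGr I) := by
  have key : ∀ (x : ⨁ n, sequencesGr I n) (n : ℕ),
      (sequencesProj I n).1 (DirectSum.coeAddMonoidHom (sequencesGr I) x) = x n := by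
    intro x n
    induction x using DirectSum.induction_on with
    | zero => simp
    | of m y =>
      rw [DirectSum.coeAddMonoidHom_of, sequencesProj_of_mem I y.2]
      split_ifs with h
      · subst h; rw [DirectSum.of_eq_same]
      · rw [DirectSum.of_eq_of_ne _ _ _ (Ne.symm h)]; rfl
    | add x y hx hy => rw [map_add, map_add, hx, hy]; rfl
  constructor
  · refine (injective_iff_map_eq_zero _).2 fun x hx => ?_
    refine DFinsupp.ext fun n => Subtype.ext ?_
    rw [← key, hx, map_zero]; rfl
  · intro z
    induction z using split_induction with
    | split f w =>
      exact ⟨DirectSum.of (fun n => sequencesGr I n) f.brackets ⟨_, split_mem I rfl w⟩,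
        DirectSum.coeAddMonoidHom_of _ _ _⟩
    | add x y hx hy =>
      obtain ⟨a, rfl⟩ := hx
      obtain ⟨b, rfl⟩ := hy
      exact ⟨a + b, map_add _ _ _⟩

theorem split_powGr (f : Forest) (w : f.obj I) :
    ∃ z ∈ (Binfinity I).powGr f.len f.brackets, (f.split I).1 w = (tincl (trees I) f.len).1 z := by
  match f with
  | .one t => exact ⟨_, AddSubgroup.subset_closure ⟨t, w, rfl, rfl⟩, rfl⟩
  | .cons t f =>
    induction w using Forest.cons_induction with
    | cons x w =>
      obtain ⟨z, hz, e⟩ := split_powGr f w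
      rw [split_consTm, e]
      exact ⟨powCons ((inTrees I t).1 x) z, AddSubgroup.subset_closure
        ⟨t, x, f.brackets, z, hz, rfl, rfl⟩, (tincl_powCons _ _).symm⟩
    | add x y hx hy =>
      obtain ⟨z, hz, e⟩ := hx
      obtain ⟨z', hz', e'⟩ := hy
      exact ⟨z + z', add_mem hz hz', by
        rw [map_add, e, e']; exact (map_add (tincl (trees I) _).1 z z').symm⟩

theorem tincl_mem_sequencesGr (k m : ℕ) (w : pow (trees I) k)
    (hw : w ∈ (Binfinity I).powGr k m) : (tincl (trees I) k).1 w ∈ sequencesGr I m := by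
  induction k generalizing m with
  | zero =>
    induction hw using AddSubgroup.closure_induction with
    | mem y hy =>
      obtain ⟨t, x, h, rfl⟩ := hy
      exact split_mem I (f := .one t) h (Forest.single x)
    | zero => exact (congrArg (· ∈ _) (map_zero (tincl (trees I) 0).1)).mpr (zero_mem _)
    | add a b _ _ ha hb =>
      exact (congrArg (· ∈ _) (map_add (tincl (trees I) 0).1 a b)).mpr (add_mem ha hb)
    | neg a _ ha => exact (congrArg (· ∈ _) (map_neg (tincl (trees I) 0).1 a)).mpr (neg_mem ha)
  | succ k ih =>
    induction hw using AddSubgroup.closure_induction with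
    | mem y hy =>
      obtain ⟨t, x, b, w, hw, rfl, rfl⟩ := hy
      refine (congrArg (· ∈ _) (tincl_powCons ((inTrees I t).1 x) w)).mpr ?_
      exact mul_mem_sequencesGr I (split_mem I (f := .one t) rfl (Forest.single x)) (ih b w hw)
    | zero => exact (congrArg (· ∈ _) (map_zero (tincl (trees I) (k + 1)).1)).mpr (zero_mem _)
    | add a b _ _ ha hb =>
      exact (congrArg (· ∈ _) (map_add (tincl (trees I) (k + 1)).1 a b)).mpr (add_mem ha hb)
    | neg a _ ha =>
      exact (congrArg (· ∈ _) (map_neg (tincl (trees I) (k + 1)).1 a)).mpr (neg_mem ha)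

theorem cobarGr_eq : (Binfinity I).cobarGr = sequencesGr I := by
  funext m
  refine le_antisymm ((AddSubgroup.closure_le _).2 ?_) ((AddSubgroup.closure_le _).2 ?_)
  · rintro z ⟨k, w, hw, rfl⟩
    exact tincl_mem_sequencesGr I k m w hw
  · rintro z ⟨f, w, rfl, rfl⟩
    obtain ⟨z, hz, e⟩ := split_powGr I f w
    exact AddSubgroup.subset_closure ⟨_, z, hz, e⟩

theorem cobar_isDGAlgebra : (Binfinity I).cobar.IsDGAlgebra where
  mul_assoc := fun x y z => mul_assoc (G := talg (trees I)) x y z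
  left_gr := by
    intro n s x hx
    change x ∈ (Binfinity I).cobarGr n at hx
    change s • x ∈ (Binfinity I).cobarGr n
    rw [cobarGr_eq] at hx ⊢
    refine sequencesGr_induction I (p := fun x _ => s • x ∈ sequencesGr I n) ?_ ?_ ?_ hx
    · intro f h w
      rw [← ((f.split I).2 s w).1]
      exact split_mem I h _
    · intro a b _ _ ha hb
      rw [smul_add]; exact add_mem ha hb
    · rw [smul_zero]; exact zero_mem _
  right_gr := by
    intro n s x hx
    change x ∈ (Binfinity I).cobarGr n at hx
    change op s • x ∈ (Binfinity I).cobarGr n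
    rw [cobarGr_eq] at hx ⊢
    refine sequencesGr_induction I (p := fun x _ => op s • x ∈ sequencesGr I n) ?_ ?_ ?_ hx
    · intro f h w
      rw [← ((f.split I).2 s w).2]
      exact split_mem I h _
    · intro a b _ _ ha hb
      rw [smul_add]; exact add_mem ha hb
    · rw [smul_zero]; exact zero_mem _
  internal := by
    change DirectSum.IsInternal (Binfinity I).cobarGr
    rw [cobarGr_eq]
    exact isInternal_sequencesGr I
  mul_gr := by
    intro m n x hx y hy
    change x ∈ (Binfinity I).cobarGr m at hx
    change y ∈ (Binfinity I).cobarGr n at hy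
    change _ ∈ (Binfinity I).cobarGr (m + n)
    rw [cobarGr_eq] at hx hy ⊢
    exact mul_mem_sequencesGr I hx hy
  d_gr_zero := by
    intro x hx
    change x ∈ (Binfinity I).cobarGr 0 at hx
    rw [cobarGr_eq] at hx
    exact cobarD_of_mem_zero I hx
  d_gr_succ := by
    intro n x hx
    change x ∈ (Binfinity I).cobarGr (n + 1) at hx
    change _ ∈ (Binfinity I).cobarGr n
    rw [cobarGr_eq] at hx ⊢
    exact cobarD_mem I hx
  leibniz := by
    intro n x hx y
    change x ∈ (Binfinity I).cobarGr n at hx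
    rw [cobarGr_eq] at hx
    exact cobarD_mul I hx y
  d_d := cobarD_cobarD I

/-! ### The augmentation -/

theorem wordsOut_split {f : Forest} (h : f.flat = false) (w : f.obj I) :
    (wordsOut I).1 ((f.split I).1 w) = 0 := by
  match f, h with
  | .one (.bracket a c), _ =>
    refine (talgMap_letter _ _).trans ?_
    exact (congrArg (letter V).1 (inputProj_bracket I a c w)).trans (map_zero _)
  | .cons t f, h =>
    induction w using Forest.cons_induction with
    | cons x w =>
      rw [split_consTm]
      refine (talgMap_letter_mul _ _ _).trans ?_
      match t with
      | .input =>
        refine (congrArg (_ * ·) (wordsOut_split (f := f) (by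
          simpa [Forest.flat, Tree.isInput] using h) w)).trans (mul_zero _)
      | .bracket a c => rw [inputProj_bracket, map_zero, zero_mul]
    | add x y hx hy => rw [map_add, map_add, hx, hy, add_zero]

theorem wordsOut_unwrap_mem (e : forests I) :
    (wordsOut I).1 ((unwrap I).1 e) ∈ I.toAddSubgroup := by
  induction e using sum_induction with
  | zero => rw [map_zero, map_zero]; exact zero_mem _
  | incl f e =>
    induction e using Forest.enc_cases with
    | flat h r => rw [unwrap_encFlat, wordsOut_wordsIn]; exact r.2
    | nonflat h w => rw [unwrap_encNonflat, wordsOut_split I h]; exact zero_mem _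
  | add x y hx hy => rw [map_add, map_add]; exact add_mem hx hy

theorem wordsOut_cobarD_mem (z : talg (trees I)) :
    (wordsOut I).1 ((cobarD I).1 z) ∈ I.toAddSubgroup := by
  induction z using split_induction with
  | split f w => rw [cobarD_split]; exact wordsOut_unwrap_mem I _
  | add x y hx hy => rw [map_add, map_add]; exact add_mem hx hy

/-- The morphism from the cobar construction of `B^∞(V,I)` to `T(V)/I` which extends the quotient
map on `V`. -/
def augmentation : DGHom (Binfinity I).cobar I.algebra where
  hom := I.mkQ.comp (wordsOut I)
  map_mult := fun x y => congrArg I.mkQ.1 (talgMap_mul _ x y)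
  map_gr := by
    intro n x hx
    change x ∈ (Binfinity I).cobarGr n at hx
    rw [cobarGr_eq] at hx
    change I.mkQ.1 ((wordsOut I).1 x) ∈ (if n = 0 then ⊤ else ⊥ : AddSubgroup _)
    split_ifs with hn
    · exact AddSubgroup.mem_top _
    · rw [AddSubgroup.mem_bot]
      induction hx using sequencesGr_induction with
      | split f h w =>
        rw [wordsOut_split I, map_zero]
        rw [← Bool.not_eq_true, Forest.flat_iff, h]
        exact hn
      | add x y _ _ hx hy => rw [map_add, map_add, hx, hy, add_zero]
      | zero => rw [map_zero, map_zero]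
  map_d := fun x => (QuotientAddGroup.eq_zero_iff _).2 (wordsOut_cobarD_mem I x)

/-! ### The contracting homotopy in positive degrees -/

/-- The inverse of `unwrap` on sequences that contain a bracket; it vanishes on sequences of
inputs. -/
def wrap : Hom (talg (trees I)) (forests I) :=
  (sumLift (fun f : Forest => (inForests I f).comp (f.toEnc I))).comp (toSequences I)

theorem wrap_split (f : Forest) (w : f.obj I) :
    (wrap I).1 ((f.split I).1 w) = (inForests I f).1 ((f.toEnc I).1 w) := by
  rw [wrap, Hom.comp_apply, toSequences_split, sumLift_incl, Hom.comp_apply]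

theorem wrap_unwrap {n l : ℕ} {e : forests I} (he : e ∈ forestsGr I (n + 2) l) :
    (wrap I).1 ((unwrap I).1 e) = e := by
  induction he using AddSubgroup.closure_induction with
  | mem e he =>
    obtain ⟨f, e, h, -, rfl⟩ := he
    rw [unwrap_inForests, wrap_split]
    congr 1
    induction e using Forest.enc_cases with
    | flat hf r => rw [(Forest.flat_iff f).1 hf] at h; omega
    | nonflat hf w => rw [Forest.unbracket_encNonflat, Forest.toEnc_of_nonflat hf]
  | zero => simp only [map_zero]
  | add a b _ _ ha hb => simp only [map_add, ha, hb]
  | neg a _ ha => simp only [map_neg, ha]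

theorem wrap_unwrap_eq_zero {l : ℕ} {e : forests I} (he : e ∈ forestsGr I 1 l) :
    (wrap I).1 ((unwrap I).1 e) = 0 := by
  induction he using AddSubgroup.closure_induction with
  | mem e he =>
    obtain ⟨f, e, h, -, rfl⟩ := he
    rw [unwrap_inForests, wrap_split, Forest.toEnc_of_flat ((Forest.flat_iff f).2 (by omega)),
      map_zero]
  | zero => simp only [map_zero]
  | add a b _ _ ha hb => simp only [map_add, ha, hb, add_zero]
  | neg a _ ha => simp only [map_neg, ha, neg_zero]

/-- The homotopy, which encloses sequences that have at least two entries and contain a bracket, and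
vanishes on all other sequences. -/
def homotopy : Hom (talg (trees I)) (talg (trees I)) :=
  (letter (trees I)).comp ((close I).comp (wrap I))

theorem homotopy_apply (z : talg (trees I)) :
    (homotopy I).1 z = (letter (trees I)).1 ((close I).1 ((wrap I).1 z)) := rfl

theorem homotopy_letter (a : trees I) : (homotopy I).1 ((letter (trees I)).1 a) = 0 := by
  induction a using sum_induction with
  | zero => simp only [map_zero]
  | incl t x =>
    rw [homotopy_apply, ← split_single I x, wrap_split, close_inForests_one, map_zero]
  | add x y hx hy => rw [map_add, map_add, hx, hy, add_zero]

theorem homotopy_mem {n : ℕ} {z : talg (trees I)} (hz : z ∈ sequencesGr I n) :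
    (homotopy I).1 z ∈ sequencesGr I (n + 1) := by
  induction hz using sequencesGr_induction with
  | split f h w =>
    match f with
    | .one t =>
      rw [show (Forest.split I (.one t)).1 w = (letter (trees I)).1 ((inTrees I t).1 w) from rfl,
        homotopy_letter]
      exact zero_mem _
    | .cons t f =>
      rw [homotopy_apply, wrap_split]
      exact letter_close_mem I
        (inForests_mem_forestsGr I (congrArg (· + 1) h) (Nat.le_add_left _ _) _)
  | add x y _ _ hx hy => rw [map_add]; exact add_mem hx hy
  | zero => rw [map_zero]; exact zero_mem _

theorem homotopy_add_of_two_le {n : ℕ} {z : talg (trees I)} (hz : z ∈ sequencesGr I (n + 2)) :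
    (cobarD I).1 ((homotopy I).1 z) + (homotopy I).1 ((cobarD I).1 z) = z := by
  induction hz using sequencesGr_induction with
  | split f h w =>
    match f with
    | .one .input => simp [Forest.brackets, Tree.brackets] at h
    | .one (.bracket t f) =>
      induction w using Tree.enclose_cases with
      | h e =>
        have h' : (Forest.cons t f).brackets + 1 = n + 2 := h
        change (cobarD I).1 ((homotopy I).1 ((letter (trees I)).1
          ((inTrees I (.bracket t f)).1 (Tree.enclose e)))) + (homotopy I).1 ((cobarD I).1
          ((letter (trees I)).1 ((inTrees I (.bracket t f)).1 (Tree.enclose e)))) =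
          (letter (trees I)).1 ((inTrees I (.bracket t f)).1 (Tree.enclose e))
        rw [homotopy_letter, map_zero, zero_add, cobarD_enclose, map_sub, homotopy_letter, sub_zero,
          homotopy_apply, wrap_unwrap I (inForests_mem_forestsGr I h' (Nat.zero_le _) e),
          close_inForests_cons]
    | .cons t f =>
      have hf : (Forest.cons t f).flat = false := by
        rw [← Bool.not_eq_true, Forest.flat_iff, h]; omega
      have he := inForests_mem_forestsGr I (congrArg (· + 1) h) (Nat.le_add_left 1 f.len)
        (Forest.encNonflat hf w)
      have hd := Forest.delta_mem I (.cons t f) w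
      rw [h] at hd
      rw [homotopy_apply, wrap_split, Forest.toEnc_of_nonflat hf, cobarD_close I he,
        unwrap_encNonflat, innerDelta_inForests, Forest.unbracket_encNonflat, cobarD_split,
        homotopy_apply, wrap_unwrap I hd, sub_add_cancel]
  | add x y _ _ hx hy =>
    rw [map_add, map_add, map_add, map_add, add_add_add_comm, hx, hy]
  | zero => simp only [map_zero, add_zero]

/-- In degree one, the identity and `dh + hd` differ only by elements of the ideal, placed in an
innermost bracket. -/
theorem exists_homotopy_add_of_one {z : talg (trees I)} (hz : z ∈ sequencesGr I 1) :
    ∃ e ∈ forestsGr I 1 1, z = (cobarD I).1 ((homotopy I).1 z) +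
      (homotopy I).1 ((cobarD I).1 z) + (letter (trees I)).1 ((close I).1 e) := by
  induction hz using sequencesGr_induction with
  | split f h w =>
    match f with
    | .one .input => simp [Forest.brackets, Tree.brackets] at h
    | .one (.bracket t f) =>
      induction w using Tree.enclose_cases with
      | h e =>
        have h' : (Forest.cons t f).brackets + 1 = 1 := h
        refine ⟨_, inForests_mem_forestsGr I h' (Nat.le_add_left 1 f.len) e, ?_⟩
        change (letter (trees I)).1 ((inTrees I (.bracket t f)).1 (Tree.enclose e)) =
          (cobarD I).1 ((homotopy I).1 ((letter (trees I)).1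
          ((inTrees I (.bracket t f)).1 (Tree.enclose e)))) + (homotopy I).1 ((cobarD I).1
          ((letter (trees I)).1 ((inTrees I (.bracket t f)).1 (Tree.enclose e)))) + _
        rw [homotopy_letter, map_zero, zero_add, cobarD_enclose, map_sub, homotopy_letter, sub_zero,
          homotopy_apply, wrap_unwrap_eq_zero I (inForests_mem_forestsGr I h' (Nat.zero_le _) e),
          map_zero, map_zero, zero_add, close_inForests_cons]
    | .cons t f =>
      have hf : (Forest.cons t f).flat = false := by
        rw [← Bool.not_eq_true, Forest.flat_iff, h]; omega
      have he := inForests_mem_forestsGr I (congrArg (· + 1) h) (Nat.le_add_left 1 f.len)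
        (Forest.encNonflat hf w)
      have hd : (Forest.delta I (.cons t f)).1 w ∈ forestsGr I 1 1 :=
        (congrArg (_ ∈ forestsGr I · 1) h).mp (AddSubgroup.closure_mono
          (by rintro z ⟨g, e, hn, hl, rfl⟩; exact ⟨g, e, hn, (Nat.le_add_left _ _).trans hl, rfl⟩)
          (Forest.delta_mem I (.cons t f) w))
      refine ⟨_, hd, ?_⟩
      rw [homotopy_apply, wrap_split, Forest.toEnc_of_nonflat hf, cobarD_close I he,
        unwrap_encNonflat, innerDelta_inForests, Forest.unbracket_encNonflat, cobarD_split,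
        homotopy_apply, wrap_unwrap_eq_zero I hd, map_zero, map_zero, add_zero, sub_add_cancel]
  | add x y _ _ hx hy =>
    obtain ⟨a, ha, ea⟩ := hx
    obtain ⟨b, hb, eb⟩ := hy
    refine ⟨a + b, add_mem ha hb, ?_⟩
    nth_rewrite 1 [ea, eb]
    simp only [map_add]
    abel
  | zero => exact ⟨0, zero_mem _, by simp only [map_zero, add_zero]⟩

/-- Cycles of positive degree are boundaries. -/
theorem cobarD_homotopy_of_cycle {n : ℕ} {z : talg (trees I)} (hz : z ∈ sequencesGr I (n + 1))
    (h : (cobarD I).1 z = 0) : (cobarD I).1 ((homotopy I).1 z) = z := by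
  cases n with
  | succ n => simpa only [h, map_zero, add_zero] using homotopy_add_of_two_le I hz
  | zero =>
    obtain ⟨e, he, hze⟩ := exists_homotopy_add_of_one I hz
    rw [h, map_zero, add_zero] at hze
    -- Applying the differential shows that `e`, as an element of the ideal, is zero.
    have h1 := congrArg (cobarD I).1 hze
    have h2 : (innerDelta I).1 e = 0 := by
      have := innerDelta_mem I (n := 0) he
      rwa [forestsGr_zero, AddSubgroup.mem_bot] at this
    rw [h, map_add, cobarD_cobarD, zero_add, cobarD_close I he, h2, map_zero, map_zero,
      sub_zero] at h1
    rw [unwrap_injective I e h1.symm, map_zero, map_zero, add_zero] at hze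
    exact hze.symm

/-! ### Homology in degree zero -/

theorem wordsIn_wordsOut {z : talg (trees I)} (hz : z ∈ sequencesGr I 0) :
    (wordsIn I).1 ((wordsOut I).1 z) = z := by
  induction hz using sequencesGr_induction with
  | split f h w =>
    obtain ⟨-, e⟩ := word_of_flat I f ((Forest.flat_iff f).2 h) w
    rw [← e, wordsOut_wordsIn]
  | add x y _ _ hx hy => rw [map_add, map_add, hx, hy]
  | zero => rw [map_zero, map_zero]

theorem wordsIn_mem (x : talg V) : (wordsIn I).1 x ∈ sequencesGr I 0 := by
  induction x using talg_induction with
  | letter a =>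
    refine (congrArg (· ∈ _) (talgMap_letter (inputs I) a)).mpr ?_
    exact split_mem I (f := .one .input) rfl (Forest.single (t := .input) a)
  | cons a w ih =>
    refine (congrArg (· ∈ _) (talgMap_letter_mul (inputs I) a w)).mpr ?_
    exact mul_mem_sequencesGr I (m := 0) (n := 0)
      (split_mem I (f := .one .input) rfl (Forest.single (t := .input) a)) ih
  | add x y hx hy => rw [map_add]; exact add_mem hx hy

/-- There are innermost brackets around any number `n + 2` of inputs. -/
theorem exists_flat (n : ℕ) : ∃ (t : Tree) (f : Forest),
    (Forest.cons t f).flat = true ∧ (Forest.cons t f).len = n + 1 := by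
  induction n with
  | zero => exact ⟨.input, .one .input, rfl, rfl⟩
  | succ n ih =>
    obtain ⟨t, f, h, h'⟩ := ih
    exact ⟨.input, .cons t f, by simpa [Forest.flat, Tree.isInput] using h,
      congrArg (· + 1) h'⟩

theorem exists_cobarD_eq_wordsIn_tincl (n : ℕ) (x : pow V (n + 1))
    (hx : (tincl V (n + 1)).1 x ∈ I.toAddSubgroup) :
    ∃ z ∈ sequencesGr I 1, (cobarD I).1 z = (wordsIn I).1 ((tincl V (n + 1)).1 x) := by
  obtain ⟨t, f, hf, hl⟩ := exists_flat n
  generalize n + 1 = m at x hx hl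
  subst hl
  have he := inForests_mem_forestsGr I (n := 1) (l := 1) (f := .cons t f)
    (by rw [(Forest.flat_iff _).1 hf]) (Nat.le_add_left _ _)
    (Forest.encFlat hf (⟨x, hx⟩ : I.R (Forest.cons t f).len))
  have h2 := innerDelta_mem I (n := 0) he
  rw [forestsGr_zero, AddSubgroup.mem_bot] at h2
  refine ⟨_, letter_close_mem I he, ?_⟩
  rw [cobarD_close I he, h2, map_zero, map_zero, sub_zero]
  exact unwrap_encFlat I hf _

open scoped Classical in
theorem sum_mem_of_proj {ι : Type} {M : ι → Bimodule.{u, v} S} (H : AddSubgroup (sum M)) (z : sum M)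
    (h : ∀ i, (incl M i).1 ((proj M i).1 z) ∈ H) : z ∈ H := by
  have e := DirectSum.sum_support_of (β := fun i => (M i : Type v)) z
  rw [← e]
  exact sum_mem fun i _ => h i

/-- Elements of the ideal are boundaries: a homogeneous component is the boundary of the same
element placed in an innermost bracket. -/
theorem exists_cobarD_eq_wordsIn {y : talg V} (hy : y ∈ I.toAddSubgroup) :
    ∃ z ∈ sequencesGr I 1, (cobarD I).1 z = (wordsIn I).1 y := by
  refine sum_mem_of_proj (((sequencesGr I 1).map (cobarD I).1).comap (wordsIn I).1) y fun n => ?_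
  cases n with
  | zero =>
    rw [show (proj (pow V) 0).1 y = 0 from I.minimal hy, map_zero]
    exact zero_mem _
  | succ n => exact exists_cobarD_eq_wordsIn_tincl I n _ (I.homogeneous hy (n + 1))

theorem augmentation_isQuasiIso : (augmentation I).IsQuasiIso := by
  intro n
  constructor
  · refine (injective_iff_map_eq_zero _).2 fun z hz => ?_
    obtain ⟨⟨z, hzn, hzd⟩, rfl⟩ := QuotientAddGroup.mk_surjective z
    refine (QuotientAddGroup.eq_zero_iff _).2 ?_
    change z ∈ (Binfinity I).cobarGr n at hzn
    change z ∈ ((Binfinity I).cobarGr (n + 1)).map (cobarD I).1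
    rw [cobarGr_eq] at hzn ⊢
    cases n with
    | succ n => exact ⟨_, homotopy_mem I hzn, cobarD_homotopy_of_cycle I hzn hzd⟩
    | zero =>
      have h0 := (QuotientAddGroup.eq_zero_iff _).1 hz
      obtain ⟨b, -, hb⟩ := h0
      have h1 : I.mkQ.1 ((wordsOut I).1 z) = 0 := hb.symm
      obtain ⟨y, hy, e⟩ := exists_cobarD_eq_wordsIn I ((QuotientAddGroup.eq_zero_iff _).1 h1)
      exact ⟨y, hy, e.trans (wordsIn_wordsOut I hzn)⟩
  · intro a
    obtain ⟨⟨a, han, had⟩, rfl⟩ := QuotientAddGroup.mk_surjective a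
    cases n with
    | succ n =>
      have ha : a = 0 := han
      subst ha
      exact ⟨0, map_zero _⟩
    | zero =>
      obtain ⟨x, rfl⟩ := QuotientAddGroup.mk_surjective a
      have hx := wordsIn_mem I x
      refine ⟨QuotientAddGroup.mk ⟨(wordsIn I).1 x, ?_, cobarD_of_mem_zero I hx⟩, ?_⟩
      · change _ ∈ (Binfinity I).cobarGr 0
        rw [cobarGr_eq]
        exact hx
      · refine congrArg QuotientAddGroup.mk (Subtype.ext ?_)
        exact congrArg I.mkQ.1 (wordsOut_wordsIn I x)

theorem augmentation_generator (x : V) :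
    (augmentation I).hom (generator I x) = I.mkQ (tincl V 0 x) := by
  refine congrArg I.mkQ.1 ((talgMap_letter _ _).trans ?_)
  exact congrArg (letter V).1 (inputProj_inputs I x)

end Brackets

/-! ### From the cobar differential to the Stasheff identities -/

section Components

variable {M : Bimodule.{u, v} S}

/-- The projection of the tensor algebra to words with `n + 1` letters. -/
def component (M : Bimodule.{u, v} S) (n : ℕ) : Hom (talg M) (talg M) :=
  (tincl M n).comp (tproj M n)

theorem component_tincl (m n : ℕ) (w : pow M m) :
    (component M n).1 ((tincl M m).1 w) = if m = n then (tincl M m).1 w else 0 := by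
  rw [component, Hom.comp_apply]
  split_ifs with h
  · subst h; rw [proj_incl]
  · rw [proj_incl_ne h, map_zero]

theorem component_mul_tincl (k n : ℕ) (u : talg M) (w : pow M k) :
    (component M (k + n + 1)).1 (u * (tincl M k).1 w) = (component M n).1 u * (tincl M k).1 w := by
  induction u using sum_induction with
  | zero => simp only [zero_mul, map_zero]
  | incl m u =>
    obtain ⟨z, hz⟩ := exists_tincl_mul m k u w
    rw [hz, component_tincl, component_tincl]
    by_cases h : m = n
    · rw [if_pos h, if_pos (by omega), hz]
    · rw [if_neg h, if_neg (by omega), zero_mul]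
  | add x y hx hy => simp only [add_mul, map_add, hx, hy]

theorem component_mul_tincl_eq_zero {k n : ℕ} (h : n ≤ k) (u : talg M) (w : pow M k) :
    (component M n).1 (u * (tincl M k).1 w) = 0 := by
  induction u using sum_induction with
  | zero => simp only [zero_mul, map_zero]
  | incl m u =>
    obtain ⟨z, hz⟩ := exists_tincl_mul m k u w
    rw [hz, component_tincl, if_neg (by omega)]
  | add x y hx hy => simp only [add_mul, map_add, hx, hy, add_zero]

theorem component_letter_mul (n : ℕ) (a : M) (w : talg M) :
    (component M (n + 1)).1 ((letter M).1 a * w) = (letter M).1 a * (component M n).1 w := by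
  induction w using sum_induction with
  | zero => simp only [mul_zero, map_zero]
  | incl m w =>
    rw [← tincl_powCons, component_tincl, component_tincl]
    by_cases h : m = n
    · rw [if_pos h, if_pos (by omega), tincl_powCons]
    · rw [if_neg h, if_neg (by omega), mul_zero]
  | add x y hx hy => simp only [mul_add, map_add, hx, hy]

theorem component_zero_letter_mul (a : M) (w : talg M) :
    (component M 0).1 ((letter M).1 a * w) = 0 := by
  induction w using sum_induction with
  | zero => simp only [mul_zero, map_zero]
  | incl m w =>
    rw [← tincl_powCons, component_tincl, if_neg (by omega)]
  | add x y hx hy => simp only [mul_add, map_add, hx, hy, add_zero]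

end Components

namespace CoalgData

variable {K : CoalgData.{u, v} S}

theorem neg_one_pow_smul_congr {A : Type*} [AddCommGroup A] {m n : ℕ} (h : Even (m + n)) (x : A) :
    (-1 : ℤ) ^ m • x = (-1 : ℤ) ^ n • x := by
  have : (-1 : ℤ) ^ m = (-1 : ℤ) ^ n := by
    rw [neg_one_pow_eq_pow_mod_two, neg_one_pow_eq_pow_mod_two (n := n)]
    congr 1
    rw [Nat.even_iff] at h
    omega
  rw [this]

theorem sgn_sgn (p : ℕ) (a : K.total) : (K.sgn p).1 ((K.sgn p).1 a) = a := by
  induction a using sum_induction with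
  | zero => simp only [map_zero]
  | incl x y => rw [sgn_incl, map_zsmul, sgn_incl, smul_smul, ← mul_pow]; simp
  | add a b ha hb => rw [map_add, map_add, ha, hb]

theorem shift_tincl (k : ℕ) (w : pow K.total k) :
    K.shift.1 ((tincl K.total k).1 w) = (tincl K.total k).1 ((K.shiftPow k).1 w) :=
  sumLift_incl _ _ _

theorem shift_shift (z : talg K.total) : K.shift.1 (K.shift.1 z) = z := by
  induction z using sum_induction with
  | zero => simp only [map_zero]
  | incl k w =>
    induction k with
    | zero => exact (congrArg _ (shift_letter w)).trans (shift_letter w)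
    | succ k ih =>
      induction w using pow_succ_induction with
      | cons a w =>
        rw [tincl_powCons, shift_letter_mul_tincl, shift_tincl, shift_letter_mul_tincl, sgn_sgn,
          ← shift_tincl, ih]
      | add x y hx hy => rw [map_add, map_add, map_add, hx, hy]
  | add x y hx hy => rw [map_add, map_add, hx, hy]

theorem component_shift (n : ℕ) (z : talg K.total) :
    (component K.total n).1 (K.shift.1 z) = K.shift.1 ((component K.total n).1 z) := by
  induction z using sum_induction with
  | zero => simp only [map_zero]
  | incl k w =>
    rw [shift_tincl, component_tincl, component_tincl]
    split_ifs
    · rw [shift_tincl]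
    · rw [map_zero]
  | add x y hx hy => simp only [map_add, hx, hy]

variable (K)

/-- The map `[1]^{⊗ (k+1)}`, where the signs for each letter of degree `m` are multiplied by
`(-1)^{t m}`. It describes the effect of `[1]^{⊗ (k+t+1)}` on the first `k + 1` letters. -/
def shiftPowBy (t : ℕ) : (k : ℕ) → Hom (pow K.total k) (pow K.total k)
  | 0 => K.sgn t
  | k + 1 => map (K.sgn (k + 1 + t)) (shiftPowBy t k)

/-- The map given by `shiftPowBy` on all tensor powers. -/
def shiftBy (t : ℕ) : Hom (talg K.total) (talg K.total) :=
  sumLift (fun k => (tincl K.total k).comp (K.shiftPowBy t k))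

variable {K}

theorem shiftBy_letter (t : ℕ) (a : K.total) :
    (K.shiftBy t).1 ((letter K.total).1 a) = (letter K.total).1 ((K.sgn t).1 a) :=
  sumLift_incl _ _ _

theorem shiftBy_letter_mul_tincl (t k : ℕ) (a : K.total) (w : pow K.total k) :
    (K.shiftBy t).1 ((letter K.total).1 a * (tincl K.total k).1 w) =
      (letter K.total).1 ((K.sgn (k + 1 + t)).1 a) * (K.shiftBy t).1 ((tincl K.total k).1 w) := by
  rw [← tincl_powCons]
  refine (sumLift_incl _ _ _).trans ?_
  refine (tincl_powCons (M := K.total) ((K.sgn (k + 1 + t)).1 a) ((K.shiftPowBy t k).1 w)).trans ?_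
  exact congrArg (fun z => (letter K.total).1 ((K.sgn (k + 1 + t)).1 a) * z)
    (sumLift_incl (fun k => (tincl K.total k).comp (K.shiftPowBy t k)) k w).symm

/-- On a product of words, `[1]^{⊗ k}` acts on the first factor with one additional sign for each
letter of the second factor. -/
theorem shift_tincl_mul_tincl (q k : ℕ) (u : pow K.total q) (w : pow K.total k) :
    K.shift.1 ((tincl K.total q).1 u * (tincl K.total k).1 w) =
      (K.shiftBy (k + 1)).1 ((tincl K.total q).1 u) * K.shift.1 ((tincl K.total k).1 w) := by
  induction q with
  | zero =>
    exact (shift_letter_mul_tincl k u w).trans (congrArg (· * _) (shiftBy_letter (k + 1) u).symm)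
  | succ q ih =>
    induction u using pow_succ_induction with
    | cons a u =>
      obtain ⟨z, hz⟩ := exists_tincl_mul q k u w
      rw [tincl_powCons, shiftBy_letter_mul_tincl, mul_assoc, mul_assoc, ← ih, hz,
        shift_letter_mul_tincl, show k + q + 1 + 1 = q + 1 + (k + 1) by omega]
    | add x y hx hy => simp only [map_add, add_mul, hx, hy]

theorem shiftBy_of_mem_powGr (t q m : ℕ) (u : pow K.total q) (hu : u ∈ K.powGr q m) :
    (K.shiftBy t).1 ((tincl K.total q).1 u) =
      (-1 : ℤ) ^ (t * (m + q + 1)) • K.shift.1 ((tincl K.total q).1 u) := by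
  induction q generalizing m with
  | zero =>
    induction hu using AddSubgroup.closure_induction with
    | mem u hu =>
      obtain ⟨x, y, rfl, rfl⟩ := hu
      refine (shiftBy_letter t _).trans ?_
      rw [sgn_incl, map_zsmul]
      exact congrArg _ (shift_letter _).symm
    | zero => simp only [map_zero, smul_zero]
    | add a b _ _ ha hb => simp only [map_add, smul_add, ha, hb]
    | neg a _ ha => simp only [map_neg, smul_neg, ha]
  | succ q ih =>
    induction hu using AddSubgroup.closure_induction with
    | mem u hu =>
      obtain ⟨x, y, b, w, hw, rfl, rfl⟩ := hu
      change (K.shiftBy t).1 ((tincl K.total (q + 1)).1 (powCons _ w)) =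
        _ • K.shift.1 ((tincl K.total (q + 1)).1 (powCons _ w))
      rw [tincl_powCons, shiftBy_letter_mul_tincl, shift_letter_mul_tincl, ih b w hw, sgn_incl,
        sgn_incl, map_zsmul, map_zsmul, smul_mul_assoc, smul_mul_assoc, mul_smul_comm, smul_smul,
        smul_smul, ← pow_add, ← pow_add]
      congr 2
      ring
    | zero => simp only [map_zero, smul_zero]
    | add a b _ _ ha hb => simp only [map_add, smul_add, ha, hb]
    | neg a _ ha => simp only [map_neg, smul_neg, ha]

variable (K)

/-- The coproduct `Δ_{q+1}`, with values in the tensor algebra. -/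
def coprodIn (q : ℕ) : Hom K.total (talg K.total) := (tincl K.total q).comp (K.coprod q)

/-- For `f` of odd degree on `K[1]`, the map `1^{⊗ r} ⊗ f ⊗ 1^{⊗ t}` on `K[1]^{⊗ (k+1)}`, where
`r + t = k`, with the Koszul sign rule. -/
def insertAt (f : Hom K.total (talg K.total)) : (r k : ℕ) → Hom (pow K.total k) (talg K.total)
  | 0, 0 => f
  | 0, k + 1 => (tmult K.total).comp (map f (tincl K.total k))
  | _ + 1, 0 => 0
  | r + 1, k + 1 => (tcons K.total).comp (map K.sgnShift (insertAt f r k))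

variable {K}

theorem insertAt_zero_powCons (f : Hom K.total (talg K.total)) (k : ℕ) (a : K.total)
    (w : pow K.total k) :
    (K.insertAt f 0 (k + 1)).1 (powCons a w) = f.1 a * (tincl K.total k).1 w := rfl

theorem insertAt_succ_powCons (f : Hom K.total (talg K.total)) (r k : ℕ) (a : K.total)
    (w : pow K.total k) : (K.insertAt f (r + 1) (k + 1)).1 (powCons a w) =
      (letter K.total).1 (K.sgnShift.1 a) * (K.insertAt f r k).1 w :=
  tcons_tm _ _

theorem applyAt_zero_powCons (p : ℕ) (f : Hom K.total (talg K.total)) (k : ℕ) (a : K.total)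
    (w : pow K.total k) :
    (K.applyAt p f 0 (k + 1)).1 (powCons a w) = f.1 a * (tincl K.total k).1 w := rfl

theorem applyAt_succ_powCons (p : ℕ) (f : Hom K.total (talg K.total)) (r k : ℕ) (a : K.total)
    (w : pow K.total k) : (K.applyAt p f (r + 1) (k + 1)).1 (powCons a w) =
      (letter K.total).1 ((K.sgn p).1 a) * (K.applyAt p f r k).1 w :=
  tcons_tm _ _

theorem insertAt_neg (f g : Hom K.total (talg K.total)) (h : ∀ a, g.1 a = -f.1 a) (r k : ℕ)
    (w : pow K.total k) : (K.insertAt g r k).1 w = -(K.insertAt f r k).1 w := by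
  induction r generalizing k with
  | zero =>
    cases k with
    | zero => exact h w
    | succ k =>
      induction w using pow_succ_induction with
      | cons a w => rw [insertAt_zero_powCons, insertAt_zero_powCons, h, neg_mul]
      | add x y hx hy => rw [map_add, map_add, hx, hy, neg_add]
  | succ r ih =>
    cases k with
    | zero => exact neg_zero.symm
    | succ k =>
      induction w using pow_succ_induction with
      | cons a w => rw [insertAt_succ_powCons, insertAt_succ_powCons, ih, mul_neg]
      | add x y hx hy => rw [map_add, map_add, hx, hy, neg_add]

theorem component_insertAt (f : Hom K.total (talg K.total)) (q r k : ℕ) (w : pow K.total k) :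
    (component K.total (k + q)).1 ((K.insertAt f r k).1 w) =
      (K.insertAt ((component K.total q).comp f) r k).1 w := by
  induction r generalizing k with
  | zero =>
    cases k with
    | zero => rw [Nat.zero_add]; rfl
    | succ k =>
      induction w using pow_succ_induction with
      | cons a w =>
        rw [insertAt_zero_powCons, insertAt_zero_powCons, Nat.add_right_comm, component_mul_tincl]
        rfl
      | add x y hx hy => rw [map_add, map_add, map_add, hx, hy]
  | succ r ih =>
    cases k with
    | zero => exact map_zero _
    | succ k =>
      induction w using pow_succ_induction with
      | cons a w =>
        rw [insertAt_succ_powCons, insertAt_succ_powCons, Nat.add_right_comm, component_letter_mul,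
          ih]
      | add x y hx hy => rw [map_add, map_add, map_add, hx, hy]

theorem component_insertAt_eq_zero (f : Hom K.total (talg K.total)) (r : ℕ) {n k : ℕ} (h : n < k)
    (w : pow K.total k) : (component K.total n).1 ((K.insertAt f r k).1 w) = 0 := by
  induction r generalizing k n with
  | zero =>
    cases k with
    | zero => omega
    | succ k =>
      induction w using pow_succ_induction with
      | cons a w =>
        rw [insertAt_zero_powCons, component_mul_tincl_eq_zero (by omega)]
      | add x y hx hy => rw [map_add, map_add, hx, hy, add_zero]
  | succ r ih =>
    cases k with
    | zero => exact map_zero _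
    | succ k =>
      induction w using pow_succ_induction with
      | cons a w =>
        rw [insertAt_succ_powCons]
        cases n with
        | zero => exact component_zero_letter_mul _ _
        | succ n => rw [component_letter_mul, ih (by omega), mul_zero]
      | add x y hx hy => rw [map_add, map_add, hx, hy, add_zero]

theorem diff_tincl (k : ℕ) (w : pow K.total k) :
    K.diff.1 ((tincl K.total k).1 w) = ∑ r ∈ Finset.range (k + 1), (K.insertAt K.dGen r k).1 w := by
  induction k with
  | zero => rw [Finset.sum_range_one]; exact diff_letter w
  | succ k ih =>
    induction w using pow_succ_induction with
    | cons a w =>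
      rw [tincl_powCons, diff_letter_mul, ih, Finset.sum_range_succ' _ (k + 1),
        insertAt_zero_powCons, add_comm, Finset.mul_sum]
      simp only [insertAt_succ_powCons]
    | add x y hx hy => simp only [map_add, hx, hy, Finset.sum_add_distrib]

/-- Only the tensor powers with at most `n + 1` factors contribute to the component of `d` in the
`(n+1)`-st tensor power, since `d` does not shorten words. -/
theorem component_diff_shift (n : ℕ) (z : talg K.total) :
    (component K.total n).1 (K.diff.1 (K.shift.1 z)) =
      ∑ k ∈ Finset.range (n + 1), ∑ r ∈ Finset.range (k + 1), (component K.total n).1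
        ((K.insertAt K.dGen r k).1 ((K.shiftPow k).1 ((tproj K.total k).1 z))) := by
  induction z using sum_induction with
  | zero => simp only [map_zero, Finset.sum_const_zero]
  | incl j w =>
    rw [shift_tincl, diff_tincl, map_sum]
    by_cases h : j ≤ n
    · refine Eq.trans ?_ (Finset.sum_eq_single_of_mem j (Finset.mem_range.2 (by omega))
        fun k _ hk => ?_).symm
      · rw [proj_incl]
      · rw [proj_incl_ne hk.symm]
        simp only [map_zero, Finset.sum_const_zero]
    · rw [Finset.sum_eq_zero fun r _ => component_insertAt_eq_zero _ r (by omega) _]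
      refine (Finset.sum_eq_zero fun k hk => ?_).symm
      have hk : j ≠ k := by rw [Finset.mem_range] at hk; omega
      rw [proj_incl_ne hk]
      simp only [map_zero, Finset.sum_const_zero]
  | add x y hx hy => simp only [map_add, hx, hy, Finset.sum_add_distrib]

theorem exists_applyAt_coprodIn (q p r k : ℕ) (w : pow K.total k) :
    ∃ z, (K.applyAt p (K.coprodIn q) r k).1 w = (tincl K.total (k + q)).1 z := by
  induction r generalizing k with
  | zero =>
    cases k with
    | zero => rw [Nat.zero_add]; exact ⟨_, rfl⟩
    | succ k =>
      induction w using pow_succ_induction with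
      | cons a w =>
        rw [applyAt_zero_powCons, Nat.add_right_comm]
        exact exists_tincl_mul q k _ w
      | add x y hx hy =>
        obtain ⟨z, hz⟩ := hx
        obtain ⟨z', hz'⟩ := hy
        exact ⟨z + z', by rw [map_add, hz, hz', map_add]⟩
  | succ r ih =>
    cases k with
    | zero => exact ⟨0, (map_zero (tincl K.total (0 + q)).1).symm⟩
    | succ k =>
      induction w using pow_succ_induction with
      | cons a w =>
        obtain ⟨z, hz⟩ := ih k w
        rw [applyAt_succ_powCons, Nat.add_right_comm, hz]
        exact ⟨powCons _ z, (tincl_powCons _ _).symm⟩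
      | add x y hx hy =>
        obtain ⟨z, hz⟩ := hx
        obtain ⟨z', hz'⟩ := hy
        exact ⟨z + z', by rw [map_add, hz, hz', map_add]⟩

theorem sgn_sgn_eq_neg (k q : ℕ) (a : K.total) :
    (K.sgn (k + q + 1)).1 ((K.sgn (q + 1)).1 a) = -K.sgnShift.1 ((K.sgn (k + 1)).1 a) := by
  induction a using sum_induction with
  | zero => simp only [map_zero, neg_zero]
  | incl x y =>
    rw [sgn_incl, sgn_incl, map_zsmul, map_zsmul, sgn_incl, sgnShift_incl, smul_smul, smul_smul,
      ← pow_add, ← pow_add, ← neg_smul, ← neg_one_mul ((-1 : ℤ) ^ _), ← pow_succ']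
    refine neg_one_pow_smul_congr ⟨(k + 2 + q) * (K.deg x + 1), by ring⟩ _
  | add x y hx hy => simp only [map_add, hx, hy, neg_add]

/-- As `Δ_{q+1}` has degree `q - 1`, the additional signs on its values agree with those on its
arguments up to `(-1)^{(q+1) t}`. -/
theorem shiftBy_coprodIn (h0 : ∀ k, ∀ x ∈ K.powGr 0 0, K.coprod k x = 0)
    (h1 : ∀ k n, ∀ x ∈ K.powGr 0 (n + 1), K.coprod k x ∈ K.powGr k n)
    (t q : ℕ) (a : K.total) :
    (K.shiftBy t).1 ((K.coprodIn q).1 a) =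
      (-1 : ℤ) ^ ((q + 1) * t) • K.shift.1 ((K.coprodIn q).1 ((K.sgn t).1 a)) := by
  induction a using sum_induction with
  | zero => simp only [map_zero, smul_zero]
  | incl x y =>
    have hx : (incl K.piece x).1 y ∈ K.powGr 0 (K.deg x) :=
      AddSubgroup.subset_closure ⟨x, y, rfl, rfl⟩
    rw [sgn_incl, map_zsmul, map_zsmul, smul_smul, ← pow_add]
    generalize hm : K.deg x = m at hx
    cases m with
    | zero =>
      have : (K.coprodIn q).1 ((incl K.piece x).1 y) = 0 :=
        (congrArg (tincl K.total q).1 (h0 q _ hx)).trans (map_zero _)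
      simp only [this, map_zero, smul_zero]
    | succ n =>
      refine (shiftBy_of_mem_powGr t q n _ (h1 q n _ hx)).trans ?_
      exact neg_one_pow_smul_congr ⟨t * (n + q + 2), by ring⟩ _
  | add x y hx hy => simp only [map_add, smul_add, hx, hy]

/-- The maps `1^{⊗ r} ⊗ Δ_s ⊗ 1^{⊗ t}` on tensor powers of `K` and of `K[1]` correspond to each
other up to the sign `(-1)^{r + s t}`. The `t` letters on the right contribute `(-1)^{s t}`, and
each letter on the left contributes `-1`, because the degrees in `K` and `K[1]` differ by one. -/
theorem shift_applyAt (h0 : ∀ k, ∀ x ∈ K.powGr 0 0, K.coprod k x = 0)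
    (h1 : ∀ k n, ∀ x ∈ K.powGr 0 (n + 1), K.coprod k x ∈ K.powGr k n)
    (q r t k : ℕ) (hk : k = t + r) (w : pow K.total k) :
    K.shift.1 ((K.applyAt (q + 1) (K.coprodIn q) r k).1 w) = (-1 : ℤ) ^ (r + (q + 1) * t) •
      (K.insertAt (K.shift.comp (K.coprodIn q)) r k).1 ((K.shiftPow k).1 w) := by
  subst hk
  induction r with
  | zero =>
    cases t with
    | zero => exact (one_smul ℤ _).symm
    | succ t =>
      induction w using pow_succ_induction with
      | cons a w =>
        refine (shift_tincl_mul_tincl q t ((K.coprod q).1 a) w).trans ?_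
        refine Eq.trans ?_ (congrArg _ (insertAt_zero_powCons _ t ((K.sgn (t + 1)).1 a)
          ((K.shiftPow t).1 w)).symm)
        refine (congrArg (· * _) (shiftBy_coprodIn h0 h1 (t + 1) q a)).trans ?_
        rw [shift_tincl, smul_mul_assoc, Nat.zero_add]
        rfl
      | add x y hx hy =>
        refine (congrArg _ (map_add _ x y)).trans ((map_add _ _ _).trans ?_)
        refine (congrArg₂ (· + ·) hx hy).trans ?_
        rw [← smul_add, ← map_add, ← map_add]
  | succ r ih =>
    change pow K.total (t + r + 1) at w
    change K.shift.1 ((K.applyAt (q + 1) (K.coprodIn q) (r + 1) (t + r + 1)).1 w) = _ •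
      (K.insertAt (K.shift.comp (K.coprodIn q)) (r + 1) (t + r + 1)).1
        ((K.shiftPow (t + r + 1)).1 w)
    induction w using pow_succ_induction with
    | cons a w =>
      obtain ⟨z, hz⟩ := exists_applyAt_coprodIn q (q + 1) r (t + r) w
      rw [applyAt_succ_powCons, hz, shift_letter_mul_tincl, ← hz, ih, sgn_sgn_eq_neg, map_neg,
        mul_smul_comm, neg_mul, smul_neg, ← neg_smul, ← neg_one_mul ((-1 : ℤ) ^ _), ← pow_succ']
      rw [show r + 1 + (q + 1) * t = r + (q + 1) * t + 1 by ring]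
      exact congrArg _ (insertAt_succ_powCons _ r (t + r) ((K.sgn (t + r + 1)).1 a)
        ((K.shiftPow (t + r)).1 w)).symm
    | add x y hx hy => simp only [map_add, smul_add, hx, hy]

/-- The Stasheff identities follow from the vanishing of the square of the cobar differential. -/
theorem stasheff_of_diff_diff (h0 : ∀ k, ∀ x ∈ K.powGr 0 0, K.coprod k x = 0)
    (h1 : ∀ k n, ∀ x ∈ K.powGr 0 (n + 1), K.coprod k x ∈ K.powGr k n)
    (hd : ∀ z, K.diff.1 (K.diff.1 z) = 0) (n : ℕ) (x : K.total) :
    ∑ p ∈ Finset.HasAntidiagonal.antidiagonal n, ∑ q ∈ Finset.HasAntidiagonal.antidiagonal p.2,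
      (-1 : ℤ) ^ (p.1 + (q.1 + 1) * q.2) •
        K.applyAt (q.1 + 1) ((tincl K.total q.1).comp (K.coprod q.1)) p.1 (p.1 + q.2)
          (K.coprod (p.1 + q.2) x) = 0 := by
  have hdx : (component K.total n).1 (K.diff.1 (K.shift.1 (K.Δ.1 x))) = 0 := by
    have h := hd ((letter K.total).1 x)
    rw [diff_letter, dGen_apply, map_neg, neg_eq_zero] at h
    rw [h, map_zero]
  rw [component_diff_shift] at hdx
  rw [← shift_shift (∑ p ∈ Finset.HasAntidiagonal.antidiagonal n, _), map_sum]
  refine (congrArg K.shift.1 ?_).trans (map_zero _)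
  rw [← neg_eq_zero, ← hdx, ← Finset.sum_neg_distrib]
  simp only [map_sum, ← Finset.sum_neg_distrib]
  rw [Finset.sum_sigma', Finset.sum_sigma']
  have hm : ∀ {m : ℕ} {a : ℕ × ℕ}, a ∈ Finset.HasAntidiagonal.antidiagonal m ↔ a.1 + a.2 = m :=
    Finset.HasAntidiagonal.mem_antidiagonal
  -- With `n = r + q + t`, the index `(r, (q, t))` corresponds to position `r` in words with
  -- `k + 1` letters, where `k = r + t`.
  refine Finset.sum_bij' (fun a _ => ⟨a.1.1 + a.2.2, a.1.1⟩)
    (fun b _ => ⟨(b.2, n - b.2), (n - b.1, b.1 - b.2)⟩) ?_ ?_ ?_ ?_ ?_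
  · rintro ⟨⟨r, m⟩, ⟨q, t⟩⟩ h
    simp only [Finset.mem_sigma, hm, Finset.mem_range] at h ⊢
    omega
  · rintro ⟨k, r⟩ h
    simp only [Finset.mem_sigma, hm, Finset.mem_range] at h ⊢
    omega
  · rintro ⟨⟨r, m⟩, ⟨q, t⟩⟩ h
    simp only [Finset.mem_sigma, hm] at h
    obtain ⟨rfl, rfl⟩ := h
    simp only [Sigma.mk.injEq, Prod.mk.injEq, heq_eq_eq]
    refine ⟨⟨trivial, ?_⟩, ?_, ?_⟩ <;> omega
  · rintro ⟨k, r⟩ h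
    simp only [Finset.mem_sigma, Finset.mem_range] at h
    simp only [Sigma.mk.injEq, heq_eq_eq, and_true]
    omega
  · rintro ⟨⟨r, m⟩, ⟨q, t⟩⟩ h
    simp only [Finset.mem_sigma, hm] at h
    obtain ⟨rfl, rfl⟩ := h
    dsimp only
    rw [map_zsmul]
    refine (congrArg (fun y => -(_ • y))
      (shift_applyAt h0 h1 q r t (r + t) (Nat.add_comm r t) _)).trans ?_
    rw [smul_smul, ← mul_pow, neg_one_mul, neg_neg, one_pow, one_smul,
      show r + (q + t) = r + t + q by omega, component_insertAt]
    refine (insertAt_neg _ _ (fun a => ?_) r (r + t) _).symm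
    rw [Hom.comp_apply, dGen_apply, map_neg, component_shift]
    rfl

end CoalgData

section Brackets

variable {V : Bimodule.{u, v} S} (I : HomogeneousIdeal V)

/-! ### The `A_∞`-coalgebra structure -/

theorem tproj_mem_powGr (k n : ℕ) {z : talg (trees I)} (hz : z ∈ sequencesGr I n) :
    (tproj (trees I) k).1 z ∈ (Binfinity I).powGr k n := by
  induction hz using sequencesGr_induction with
  | split f h w =>
    obtain ⟨z, hz, e⟩ := split_powGr I f w
    rw [e]
    by_cases hk : f.len = k
    · subst hk
      rw [← h]
      exact (congrArg (· ∈ (Binfinity I).powGr f.len f.brackets)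
        (proj_incl (M := pow (trees I)) f.len z)).mpr hz
    · exact (congrArg (· ∈ (Binfinity I).powGr k n) (proj_incl_ne hk z)).mpr
        (zero_mem ((Binfinity I).powGr k n))
  | add x y _ _ hx hy =>
    exact (congrArg (· ∈ (Binfinity I).powGr k n) (map_add (tproj (trees I) k).1 x y)).mpr
      (add_mem hx hy)
  | zero =>
    exact (congrArg (· ∈ (Binfinity I).powGr k n) (map_zero (tproj (trees I) k).1)).mpr
      (zero_mem ((Binfinity I).powGr k n))

theorem coproduct_mem (n : ℕ) (t : Tree) (h : t.brackets = n + 1) (x : t.obj I) :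
    (coproduct I).1 ((inTrees I t).1 x) ∈ sequencesGr I n := by
  match t with
  | .input => simp [Tree.brackets] at h
  | .bracket t f =>
    induction x using Tree.enclose_cases with
    | h e =>
      have he := inForests_mem_forestsGr I (f := .cons t f) h (Nat.le_add_left 1 f.len) e
      rw [coproduct_enclose]
      exact sub_mem (letter_close_mem I (innerDelta_mem I he)) (zsmul_mem (unwrap_mem I he) _)

theorem coprod_eq_zero (k : ℕ) (x : (Binfinity I).total) (hx : x ∈ (Binfinity I).powGr 0 0) :
    (Binfinity I).coprod k x = 0 := by
  induction hx using AddSubgroup.closure_induction with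
  | mem y hy =>
    obtain ⟨t, x, h, rfl⟩ := hy
    match t with
    | .input =>
      exact (congrArg (tproj (trees I) k).1 (coproduct_input I x)).trans (map_zero _)
    | .bracket t f => exact absurd h (Nat.succ_ne_zero _)
  | zero => exact map_zero _
  | add a b _ _ ha hb => exact (map_add _ a b).trans ((congrArg₂ (· + ·) ha hb).trans (add_zero 0))
  | neg a _ ha => exact (map_neg _ a).trans ((congrArg (- ·) ha).trans neg_zero)

theorem coprod_mem (k n : ℕ) (x : (Binfinity I).total) (hx : x ∈ (Binfinity I).powGr 0 (n + 1)) :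
    (Binfinity I).coprod k x ∈ (Binfinity I).powGr k n := by
  induction hx using AddSubgroup.closure_induction with
  | mem y hy =>
    obtain ⟨t, x, h, rfl⟩ := hy
    exact tproj_mem_powGr I k n (coproduct_mem I n t h x)
  | zero =>
    exact (congrArg (· ∈ (Binfinity I).powGr k n) (map_zero _)).mpr
      (zero_mem ((Binfinity I).powGr k n))
  | add a b _ _ ha hb =>
    exact (congrArg (· ∈ (Binfinity I).powGr k n) (map_add _ a b)).mpr (add_mem ha hb)
  | neg a _ ha => exact (congrArg (· ∈ (Binfinity I).powGr k n) (map_neg _ a)).mpr (neg_mem ha)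

theorem Binfinity_isAInfinityCoalgebra : (Binfinity I).IsAInfinityCoalgebra where
  deg_zero := coprod_eq_zero I
  deg_succ := coprod_mem I
  stasheff :=
    CoalgData.stasheff_of_diff_diff (coprod_eq_zero I) (coprod_mem I) (cobarD_cobarD I)

end Brackets

end

end BracketCobar

theorem theorem2p2 {S : Type u} [Ring S] (V : BracketCobar.Bimodule.{u, v} S)
    (I : BracketCobar.HomogeneousIdeal V) :
    (BracketCobar.Binfinity I).IsAInfinityCoalgebra ∧
    (BracketCobar.Binfinity I).cobar.IsDGAlgebra ∧
    ∃ ρ : BracketCobar.DGHom (BracketCobar.Binfinity I).cobar I.algebra,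
      (∀ x : V, ρ.hom (BracketCobar.generator I x) =
        I.mkQ (BracketCobar.tincl V 0 x)) ∧
      ρ.IsQuasiIso :=
  ⟨BracketCobar.Binfinity_isAInfinityCoalgebra I, BracketCobar.cobar_isDGAlgebra I,
    BracketCobar.augmentation I, BracketCobar.augmentation_generator I,
    BracketCobar.augmentation_isQuasiIso I⟩
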